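/- Let $m\ge 0$ and $n\ge 3$ be integers, and let $S^n\subset\mathbb R^{n+1}$ be the round unit sphere. For a smooth map $f:\mathbb R^m\to S^n$ write $|Tf|^2=\sum_{\alpha=1}^m|\partial_\alpha f|^2$, let $\tau(f)=\operatorname{tr}\nabla Tf$ be its tension field (the projection of $\sum_\alpha\partial_\alpha\partial_\alpha f$ to the tangent space of $S^n$ at $f$), and define its entropy by $$\lambda(f)=\sup_{x_0\in\mathbb R^m,\ t_0>0}\ \frac{t_0}{2}\int_{\mathbb R^m}|Tf|^2\,\frac{e^{-|x-x_0|^2/(4t_0)}}{(4\pi t_0)^{m/2}}\,dx\ \in[0,\infty].$$ Suppose $f:\mathbb R^m\to S^n$ is a soliton, that is, $f$ is smooth and $\tau(f)=\frac{x}{2}\lrcorner Tf$ (the derivative of $f$ at $x$ in the direction $x/2$) for all $x\in\mathbb R^m$, and suppose that $\lambda(f)<\infty$. If $f$ is entropy stable, meaning that $f$ is a local minimizer of $\lambda$ among smooth maps $\mathbb R^m\to S^n$, then $$\lambda(f)\le\frac{3n}{4(n-2)}.$$ This holds for "local minimizer" in each of the following two senses: 1. There are $k\in\mathbb N$ and $\varepsilon>0$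 such that $\lambda(f)\le\lambda(g)$ for every smooth $g:\mathbb R^m\to S^n$ with $\sup_{x}|D^j(g-f)(x)|<\varepsilon$ for all $0\le j\le k$. 2. $f$ is non-cylindrical (there is no nonzero $\zeta\in\mathbb R^m$ with $\zeta\lrcorner Tf\equiv 0$), and for every compactly supported variation of $f$ (every family of maps $f_s:\mathbb R^m\to S^n$, $s\in\mathbb R$, smooth in $(s,x)$ jointly, with $f_0=f$ and all $f_s$ equal to $f$ outside one compact set) the function $s\mapsto\lambda(f_s)$ has a local minimum at $s=0$. -/

import Mathlib

open scoped Manifold ContDiff ENNReal InnerProductSpace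

noncomputable section

namespace HarmonicSoliton

/-- Euclidean space `ℝ^d`. -/
abbrev Euc (d : ℕ) : Type := EuclideanSpace ℝ (Fin d)

/-- The round unit sphere `S^n ⊂ ℝ^(n+1)`, with Mathlib's smooth structure. -/
abbrev Sph (n : ℕ) : Type := Metric.sphere (0 : Euc (n + 1)) 1

/-- A map into the sphere, regarded as a map into the ambient `ℝ^(n+1)`. -/
def ambient {X : Type*} {n : ℕ} (f : X → Sph n) : X → Euc (n + 1) := fun x => (f x : Euc (n + 1))

/-- `f` is an element of `C^∞(ℝ^m, S^n)`. -/
def IsSmooth {m n : ℕ} (f : Euc m → Sph n) : Prop :=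
  ContMDiff (𝓡 m) (𝓡 n) ∞ f

/-- `|Tf|² = ∑ₐ |∂ₐ f|²` at `x`. As the metric of `S^n` is induced by `ℝ^(n+1)`, the partial
derivatives may be measured in the ambient space. -/
def normSqT {m n : ℕ} (f : Euc m → Sph n) (x : Euc m) : ℝ :=
  ∑ a : Fin m, ‖fderiv ℝ (ambient f) x (EuclideanSpace.single a 1)‖ ^ 2

/-- The tension field `τ(f) = tr ∇(Tf)`: the Levi-Civita connection of `S^n` is the tangential part
of the flat connection of `ℝ^(n+1)`, and the tangent space at `p` is `p^⊥`, so `τ(f)` at `x` is the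
projection to `(f x)^⊥` of `∑ₐ ∂ₐ ∂ₐ f`. -/
def tension {m n : ℕ} (f : Euc m → Sph n) (x : Euc m) : Euc (n + 1) :=
  (ℝ ∙ ambient f x)ᗮ.starProjection (Laplacian.laplacian (ambient f) x)

/-- A soliton (based at `(0,1)`): a smooth map with `τ(f) = (x/2) ⌟ Tf`. -/
def IsSoliton {m n : ℕ} (f : Euc m → Sph n) : Prop :=
  IsSmooth f ∧ ∀ x, tension f x = fderiv ℝ (ambient f) x ((1 / 2 : ℝ) • x)

/-- `𝓕_{x₀,t₀}(f) = (t₀/2) ∫ |Tf|² (4πt₀)^(-m/2) exp(-|x-x₀|²/(4t₀)) dx`, with values in `[0,∞]`. -/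
def functionalF {m n : ℕ} (x₀ : Euc m) (t₀ : ℝ) (f : Euc m → Sph n) : ℝ≥0∞ :=
  ENNReal.ofReal (t₀ / 2) * ∫⁻ x, ENNReal.ofReal
    (normSqT f x * (Real.exp (-‖x - x₀‖ ^ 2 / (4 * t₀)) / (4 * Real.pi * t₀) ^ ((m : ℝ) / 2)))

/-- The entropy `λ(f) = sup { 𝓕_{x₀,t₀}(f) : x₀ ∈ ℝ^m, t₀ > 0 }`, with values in `[0,∞]`. -/
def entropy {m n : ℕ} (f : Euc m → Sph n) : ℝ≥0∞ :=
  ⨆ (x₀ : Euc m) (t₀ : ℝ) (_ : 0 < t₀), functionalF x₀ t₀ f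

/-- `g` lies in the uniform `C^k` ball of radius `ε` around `f`. -/
def UniformlyClose {m n : ℕ} (k : ℕ) (ε : ℝ) (f g : Euc m → Sph n) : Prop :=
  ∀ j ≤ k, ∀ x, ‖iteratedFDeriv ℝ j (fun y => ambient g y - ambient f y) x‖ < ε

/-- Entropy stability: `f` is a local minimizer of `λ` on `C^∞(ℝ^m, S^n)`, for the topology of
uniform convergence of all derivatives. -/
def IsEntropyStable {m n : ℕ} (f : Euc m → Sph n) : Prop :=
  ∃ k : ℕ, ∃ ε : ℝ, 0 < ε ∧
    ∀ g : Euc m → Sph n, IsSmooth g → UniformlyClose k ε f g → entropy f ≤ entropy g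

/-- A compactly supported variation `f_s`, `s ∈ ℝ`, of `f`: jointly smooth in `(s,x)`, with `f_0 = f`
and `f_s = f` outside a compact set. -/
def IsCompactVariation {m n : ℕ} (f : Euc m → Sph n) (F : ℝ → Euc m → Sph n) : Prop :=
  ContMDiff 𝓘(ℝ, ℝ × Euc m) (𝓡 n) ∞ (fun p : ℝ × Euc m => F p.1 p.2) ∧ F 0 = f ∧
    ∃ K : Set (Euc m), IsCompact K ∧ ∀ s, ∀ x ∉ K, F s x = f x

/-- `f` is a local minimizer of `λ` along each of its compactly supported variations. -/
def IsCompactlyEntropyStable {m n : ℕ} (f : Euc m → Sph n) : Prop :=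
  ∀ F : ℝ → Euc m → Sph n, IsCompactVariation f F → IsLocalMin (fun s => entropy (F s)) 0

/-- `f` is cylindrical: `ζ ⌟ Tf ≡ 0` for some constant vector field `ζ ≠ 0`. -/
def IsCylindrical {m n : ℕ} (f : Euc m → Sph n) : Prop :=
  ∃ ζ : Euc m, ζ ≠ 0 ∧ ∀ x, fderiv ℝ (ambient f) x ζ = 0

end HarmonicSoliton

end

/-!
The Gaussian energy `F_{x₀,t₀}` of a soliton of finite entropy decreases along the parabolic paths
`σ ↦ (σ y, 1 + a σ²)` issuing from `(0, 1)`, by a Pohozaev identity with Gaussian weight; if the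
soliton is non-cylindrical, the decrease is strict, and quadratic near `(0, 1)`. Hence the entropy
is `F_{0,1}`, and for a small variation `(f + s W) / |f + s W|` only the centres near `(0, 1)`
matter. There the decrease along the paths absorbs the first variation, at the price of adding
`(3 / 2) |W|²` to the density of the second variation. So `f` is unstable as soon as
`½ ∫ ((3 / 2) |W|² + |∇W|² - |Tf|² |W|²) G_{0,1} < 0` for some compactly supported tangent field
`W`. For `W` running through the tangential projections of an orthonormal basis of `ℝ^(n+1)`, cut
off far away, these forms add up to almost `(3 / 4) n - (n - 2) λ(f)`.

For the first notion of stability a cylindrical soliton factors as `g ∘ π`, with `π` an orthogonal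
projection and `g` a non-cylindrical soliton of the same entropy; the variations of `g` compose
with `π` to variations of `f` that are uniformly small with all their derivatives.
-/

noncomputable section

namespace HarmonicSoliton

open MeasureTheory Filter Topology Set

section Derivatives

variable {E H : Type*} [NormedAddCommGroup E] [InnerProductSpace ℝ E]
  [NormedAddCommGroup H] [InnerProductSpace ℝ H]

lemma contDiff_fderiv_apply {k l : WithTop ℕ∞} {u : E → H} (hu : ContDiff ℝ k u) (v : E)
    (hl : l + 1 ≤ k := by simp) : ContDiff ℝ l (fun y => fderiv ℝ u y v) :=
  (hu.fderiv_right hl).clm_apply contDiff_const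

lemma map_eq_sum_inner_smul {ι G : Type*} [Fintype ι] [NormedAddCommGroup G] [NormedSpace ℝ G]
    (b : OrthonormalBasis ι ℝ E) (L : E →L[ℝ] G) (x : E) : L x = ∑ i, ⟪b i, x⟫_ℝ • L (b i) := by
  conv_lhs => rw [← b.sum_repr' x]
  simp only [map_sum, map_smul]

lemma fderiv_smul_add_const (c : ℝ) (b x v : E) : fderiv ℝ (fun x => c • x + b) x v = c • v := by
  have h : HasFDerivAt (fun x : E => c • x + b) (c • ContinuousLinearMap.id ℝ E) x :=
    ((hasFDerivAt_id x).const_smul c).add_const b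
  rw [h.fderiv, smul_apply, ContinuousLinearMap.id_apply]

lemma fderiv_fderiv_apply_affine {u : E → H} (hu : ContDiff ℝ 2 u) (c : ℝ) (b x v : E) :
    fderiv ℝ (fun y => fderiv ℝ u y (c • y + b)) x v =
      fderiv ℝ (fun y => fderiv ℝ u y v) x (c • x + b) + c • fderiv ℝ u x v := by
  have hd : DifferentiableAt ℝ (fderiv ℝ u) x :=
    (hu.fderiv_right (m := 1) (by norm_num)).differentiable (by simp) x
  have hsymm : IsSymmSndFDerivAt ℝ u x :=
    hu.contDiffAt.isSymmSndFDerivAt (by simp [minSmoothness_of_isRCLikeNormedField])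
  rw [fderiv_clm_apply hd (by fun_prop), fderiv_clm_apply hd (differentiableAt_const v)]
  simp only [add_apply, ContinuousLinearMap.comp_apply, ContinuousLinearMap.flip_apply,
    fderiv_smul_add_const, map_smul, hsymm.eq v]
  simp [add_comm]

end Derivatives

section EnergyDensity

variable {E H : Type*} [NormedAddCommGroup E] [InnerProductSpace ℝ E] [FiniteDimensional ℝ E]
  [NormedAddCommGroup H] [InnerProductSpace ℝ H]

/-- The pairing `⟨∇u, ∇w⟩` of the derivatives of two vector valued maps, contracted with the metric
of the domain. -/
def gradInner (u w : E → H) (x : E) : ℝ :=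
  ∑ i, ⟪fderiv ℝ u x (stdOrthonormalBasis ℝ E i), fderiv ℝ w x (stdOrthonormalBasis ℝ E i)⟫_ℝ

/-- The energy density `|∇u|²` of a vector valued map. -/
def energyDensity (u : E → H) (x : E) : ℝ := gradInner u u x

lemma energyDensity_eq_sum_norm_sq {ι : Type*} [Fintype ι] (b : OrthonormalBasis ι ℝ E)
    (u : E → H) (x : E) : energyDensity u x = ∑ i, ‖fderiv ℝ u x (b i)‖ ^ 2 := by
  let L : E →ₗ[ℝ] H := fderiv ℝ u x
  let B : E →ₗ[ℝ] E →ₗ[ℝ] ℝ := (innerₗ H).compl₁₂ L L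
  have h := congrArg (TensorProduct.lift B)
    ((InnerProductSpace.canonicalCovariantTensor_eq_sum E (stdOrthonormalBasis ℝ E)).symm.trans
      (InnerProductSpace.canonicalCovariantTensor_eq_sum E b))
  simpa only [energyDensity, gradInner, map_sum, TensorProduct.lift.tmul, B, L,
    LinearMap.compl₁₂_apply, innerₗ_apply_apply, ContinuousLinearMap.coe_coe,
    real_inner_self_eq_norm_sq] using h

lemma energyDensity_nonneg (u : E → H) (x : E) : 0 ≤ energyDensity u x := by
  rw [energyDensity_eq_sum_norm_sq (stdOrthonormalBasis ℝ E)]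
  positivity

lemma norm_fderiv_apply_sq_le (u : E → H) (x v : E) :
    ‖fderiv ℝ u x v‖ ^ 2 ≤ energyDensity u x * ‖v‖ ^ 2 := by
  have hle : ‖fderiv ℝ u x v‖ ≤ ∑ i, ‖fderiv ℝ u x (stdOrthonormalBasis ℝ E i)‖ *
      ‖⟪stdOrthonormalBasis ℝ E i, v⟫_ℝ‖ := by
    rw [map_eq_sum_inner_smul (stdOrthonormalBasis ℝ E) (fderiv ℝ u x) v]
    refine (norm_sum_le _ _).trans_eq (Finset.sum_congr rfl fun i _ => ?_)
    rw [norm_smul, mul_comm]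
  rw [energyDensity_eq_sum_norm_sq (stdOrthonormalBasis ℝ E),
    ← (stdOrthonormalBasis ℝ E).sum_sq_norm_inner_right v]
  exact (pow_le_pow_left₀ (norm_nonneg _) hle 2).trans (Finset.sum_mul_sq_le_sq_mul_sq _ _ _)

lemma contDiff_gradInner {k l : WithTop ℕ∞} {u w : E → H} (hu : ContDiff ℝ k u)
    (hw : ContDiff ℝ k w) (hl : l + 1 ≤ k := by simp) : ContDiff ℝ l (gradInner u w) :=
  ContDiff.sum fun _ _ => (contDiff_fderiv_apply hu _ hl).inner ℝ (contDiff_fderiv_apply hw _ hl)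

lemma contDiff_energyDensity {k l : WithTop ℕ∞} {u : E → H} (hu : ContDiff ℝ k u)
    (hl : l + 1 ≤ k := by simp) : ContDiff ℝ l (energyDensity u) :=
  contDiff_gradInner hu hu hl

lemma fderiv_energyDensity {u : E → H} (hu : ContDiff ℝ 2 u) (x v : E) :
    fderiv ℝ (energyDensity u) x v = 2 * ∑ i, ⟪fderiv ℝ u x (stdOrthonormalBasis ℝ E i),
      fderiv ℝ (fun y => fderiv ℝ u y (stdOrthonormalBasis ℝ E i)) x v⟫_ℝ := by
  have h := HasFDerivAt.fun_sum (u := Finset.univ) fun i _ =>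
    ((contDiff_fderiv_apply (l := 1) hu (stdOrthonormalBasis ℝ E i)
      (by norm_num)).differentiable (by simp) x).hasFDerivAt.norm_sq
  rw [funext (energyDensity_eq_sum_norm_sq (stdOrthonormalBasis ℝ E) u), h.fderiv]
  simp [Finset.mul_sum]

lemma gradInner_smul_right {u w : E → H} {φ : E → ℝ} {x : E} (hφ : DifferentiableAt ℝ φ x)
    (hw : DifferentiableAt ℝ w x) :
    gradInner u (fun y => φ y • w y) x =
      ⟪fderiv ℝ u x (gradient φ x), w x⟫_ℝ + φ x * gradInner u w x := by
  rw [map_eq_sum_inner_smul (stdOrthonormalBasis ℝ E) (fderiv ℝ u x), sum_inner]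
  simp only [gradInner, Finset.mul_sum, ← Finset.sum_add_distrib]
  refine Finset.sum_congr rfl fun i _ => ?_
  rw [fderiv_fun_smul hφ hw, real_inner_smul_left, inner_gradient_right]
  simp [inner_add_right, real_inner_smul_right]
  ring

lemma gradInner_fderiv_affine {u : E → H} (hu : ContDiff ℝ 2 u) (c : ℝ) (b x : E) :
    gradInner u (fun y => fderiv ℝ u y (c • y + b)) x =
      2⁻¹ * fderiv ℝ (energyDensity u) x (c • x + b) + c * energyDensity u x := by
  rw [fderiv_energyDensity hu, inv_mul_cancel_left₀ two_ne_zero]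
  simp only [gradInner, energyDensity, fderiv_fderiv_apply_affine hu, inner_add_right,
    real_inner_smul_right, Finset.sum_add_distrib, ← Finset.mul_sum]

end EnergyDensity

section Divergence

variable {E H : Type*} [NormedAddCommGroup E] [InnerProductSpace ℝ E]
  [NormedAddCommGroup H] [InnerProductSpace ℝ H]

/-- The divergence of a vector field, as the trace of its derivative. -/
def divergence (X : E → E) (x : E) : ℝ := LinearMap.trace ℝ E (fderiv ℝ X x)

lemma divergence_eq_sum_fderiv_inner {ι : Type*} [Fintype ι] (b : OrthonormalBasis ι ℝ E)
    {X : E → E} {x : E} (hX : DifferentiableAt ℝ X x) :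
    divergence X x = ∑ i, fderiv ℝ (fun y => ⟪b i, X y⟫_ℝ) x (b i) := by
  rw [divergence, LinearMap.trace_eq_sum_inner _ b]
  refine Finset.sum_congr rfl fun i _ => ?_
  rw [fderiv_inner_apply ℝ (differentiableAt_const _) hX]
  simp

lemma divergence_sub {X Y : E → E} {x : E} (hX : DifferentiableAt ℝ X x)
    (hY : DifferentiableAt ℝ Y x) :
    divergence (fun y => X y - Y y) x = divergence X x - divergence Y x := by
  simp only [divergence, fderiv_fun_sub hX hY, ContinuousLinearMap.toLinearMap_sub, map_sub]

variable [FiniteDimensional ℝ E]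

lemma divergence_smul {h : E → ℝ} {X : E → E} {x : E} (hh : DifferentiableAt ℝ h x)
    (hX : DifferentiableAt ℝ X x) :
    divergence (fun y => h y • X y) x = fderiv ℝ h x (X x) + h x * divergence X x := by
  rw [divergence, fderiv_fun_smul hh hX]
  simp [divergence, add_comm]

lemma divergence_smul_add_const (c : ℝ) (b x : E) :
    divergence (fun x => c • x + b) x = Module.finrank ℝ E * c := by
  have h : (fderiv ℝ (fun x : E => c • x + b) x : E →ₗ[ℝ] E) = c • LinearMap.id :=
    LinearMap.ext fun v => fderiv_smul_add_const c b x v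
  rw [divergence, h, map_smul, LinearMap.trace_id, smul_eq_mul, mul_comm]

/-- The vector field dual to `v ↦ ⟨∂ᵥ u, w⟩`, whose divergence is the integrand of the first
variation of the Dirichlet energy of `u` in the direction `w`. -/
def energyCurrent (u w : E → H) (x : E) : E :=
  ∑ i, ⟪fderiv ℝ u x (stdOrthonormalBasis ℝ E i), w x⟫_ℝ • stdOrthonormalBasis ℝ E i

lemma contDiff_energyCurrent {u w : E → H} (hu : ContDiff ℝ 2 u) (hw : ContDiff ℝ 1 w) :
    ContDiff ℝ 1 (energyCurrent u w) :=
  ContDiff.sum fun _ _ =>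
    ((contDiff_fderiv_apply hu _ (by norm_num)).inner ℝ hw).smul contDiff_const

lemma laplacian_eq_sum_fderiv {u : E → H} (hu : ContDiff ℝ 2 u) (x : E) :
    Laplacian.laplacian u x =
      ∑ i, fderiv ℝ (fun y => fderiv ℝ u y (stdOrthonormalBasis ℝ E i)) x
        (stdOrthonormalBasis ℝ E i) := by
  rw [InnerProductSpace.laplacian_eq_iteratedFDeriv_stdOrthonormalBasis]
  refine Finset.sum_congr rfl fun i _ => ?_
  have hd : DifferentiableAt ℝ (fderiv ℝ u) x :=
    (hu.fderiv_right (m := 1) (by norm_num)).differentiable (by simp) x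
  rw [iteratedFDeriv_two_apply, fderiv_clm_apply hd (differentiableAt_const _)]
  simp

lemma divergence_energyCurrent {u w : E → H} (hu : ContDiff ℝ 2 u) (hw : ContDiff ℝ 1 w) (x : E) :
    divergence (energyCurrent u w) x = gradInner u w x + ⟪Laplacian.laplacian u x, w x⟫_ℝ := by
  have hcoord : ∀ i, (fun y => ⟪stdOrthonormalBasis ℝ E i, energyCurrent u w y⟫_ℝ) =
      fun y => ⟪fderiv ℝ u y (stdOrthonormalBasis ℝ E i), w y⟫_ℝ := fun i => by
    ext y
    exact (stdOrthonormalBasis ℝ E).orthonormal.inner_right_fintype _ i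
  rw [divergence_eq_sum_fderiv_inner (stdOrthonormalBasis ℝ E)
    ((contDiff_energyCurrent hu hw).differentiable (by simp) x), laplacian_eq_sum_fderiv hu,
    sum_inner, gradInner, ← Finset.sum_add_distrib]
  refine Finset.sum_congr rfl fun i _ => ?_
  rw [hcoord, fderiv_inner_apply ℝ ((contDiff_fderiv_apply (l := 1) hu _
    (by norm_num)).differentiable (by simp) x) (hw.differentiable (by simp) x)]

variable [MeasurableSpace E] [BorelSpace E]

lemma integral_fderiv_apply_eq_zero {h : E → ℝ} (hh : ContDiff ℝ 1 h) (hc : HasCompactSupport h)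
    (v : E) : ∫ x, fderiv ℝ h x v = 0 := by
  have hint : Integrable (fun x => fderiv ℝ h x v) :=
    (contDiff_fderiv_apply (l := 0) hh v).continuous.integrable_of_hasCompactSupport
      (hc.fderiv_apply (𝕜 := ℝ) v)
  simpa using integral_mul_fderiv_eq_neg_fderiv_mul_of_integrable (μ := (volume : Measure E))
    (f := fun _ : E => (1 : ℝ)) (g := h) (v := v) (by simp) (by simpa using hint)
    (by simpa using hh.continuous.integrable_of_hasCompactSupport hc) (by simp)
    (fun x _ => hh.differentiable (by simp) x)

lemma integral_divergence_eq_zero {X : E → E} (hX : ContDiff ℝ 1 X) (hc : HasCompactSupport X) :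
    ∫ x, divergence X x = 0 := by
  let b := stdOrthonormalBasis ℝ E
  have hcoord : ∀ i, ContDiff ℝ 1 (fun y => ⟪b i, X y⟫_ℝ) := fun i => contDiff_const.inner ℝ hX
  have hsupp : ∀ i, HasCompactSupport (fun y => ⟪b i, X y⟫_ℝ) := fun i =>
    hc.comp_left (g := fun v => ⟪b i, v⟫_ℝ) (inner_zero_right _)
  simp only [fun x => divergence_eq_sum_fderiv_inner b (hX.differentiable (by simp) x)]
  rw [integral_finsetSum _ fun i _ => (contDiff_fderiv_apply (l := 0) (hcoord i)
    _).continuous.integrable_of_hasCompactSupport ((hsupp i).fderiv_apply (𝕜 := ℝ) _)]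
  exact Finset.sum_eq_zero fun i _ => integral_fderiv_apply_eq_zero (hcoord i) (hsupp i) _

lemma integral_gradInner_add_inner_laplacian {u w : E → H} (hu : ContDiff ℝ 2 u)
    (hw : ContDiff ℝ 1 w) (hc : HasCompactSupport w) :
    ∫ x, (gradInner u w x + ⟪Laplacian.laplacian u x, w x⟫_ℝ) = 0 := by
  have hsupp : HasCompactSupport (energyCurrent u w) :=
    HasCompactSupport.intro hc fun x hx => by
      simp [energyCurrent, image_eq_zero_of_notMem_tsupport hx]
  simpa only [divergence_energyCurrent hu hw] using
    integral_divergence_eq_zero (contDiff_energyCurrent hu hw) hsupp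

/-- The Pohozaev identity: the first variation in the direction `φ ∂_Y u`, with `Y x = c x + b`,
differs from the integrand below by half the divergence of `φ |∇u|² Y`. -/
lemma integral_pohozaev {u : E → H} (hu : ContDiff ℝ 2 u) {φ : E → ℝ} (hφ : ContDiff ℝ 1 φ)
    (hc : HasCompactSupport φ) (c : ℝ) (b : E) :
    ∫ x, (φ x * c * energyDensity u x - 2⁻¹ * (energyDensity u x *
      (fderiv ℝ φ x (c • x + b) + Module.finrank ℝ E * c * φ x)) +
      φ x * ⟪Laplacian.laplacian u x, fderiv ℝ u x (c • x + b)⟫_ℝ +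
      ⟪fderiv ℝ u x (gradient φ x), fderiv ℝ u x (c • x + b)⟫_ℝ) = 0 := by
  let Y : E → E := fun x => c • x + b
  let w : E → H := fun x => fderiv ℝ u x (Y x)
  have hY : ContDiff ℝ 1 Y := by fun_prop
  have hw : ContDiff ℝ 1 w := (hu.fderiv_right (by norm_num)).clm_apply hY
  have hφw : ContDiff ℝ 1 (fun x => φ x • w x) := hφ.smul hw
  have hφe : ContDiff ℝ 1 (fun x => φ x * energyDensity u x) :=
    hφ.mul (contDiff_energyDensity hu (by norm_num))
  have hφY : ContDiff ℝ 1 (fun x => (2⁻¹ * (φ x * energyDensity u x)) • Y x) :=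
    (contDiff_const.mul hφe).smul hY
  have hcur := contDiff_energyCurrent hu hφw
  let X : E → E := fun x =>
    energyCurrent u (fun y => φ y • w y) x - (2⁻¹ * (φ x * energyDensity u x)) • Y x
  have hX : ContDiff ℝ 1 X := hcur.sub hφY
  have hXc : HasCompactSupport X := HasCompactSupport.intro hc fun x hx => by
    simp [X, energyCurrent, image_eq_zero_of_notMem_tsupport hx]
  rw [← integral_divergence_eq_zero hX hXc]
  refine integral_congr_ae (Eventually.of_forall fun x => ?_)
  have hdφe : fderiv ℝ (fun x => 2⁻¹ * (φ x * energyDensity u x)) x (Y x) =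
      2⁻¹ * (φ x * fderiv ℝ (energyDensity u) x (Y x) +
        energyDensity u x * fderiv ℝ φ x (Y x)) := by
    rw [fderiv_const_mul (hφe.differentiable (by simp) x), fderiv_fun_mul
      (hφ.differentiable (by simp) x) ((contDiff_energyDensity hu (l := 1)
        (by norm_num)).differentiable (by simp) x)]
    simp [mul_add]
  rw [divergence_sub (hcur.differentiable (by simp) x) (hφY.differentiable (by simp) x),
    divergence_energyCurrent hu hφw, gradInner_smul_right (hφ.differentiable (by simp) x)
      (hw.differentiable (by simp) x), gradInner_fderiv_affine hu,
    divergence_smul ((contDiff_const.mul hφe).differentiable (by simp) x)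
      (hY.differentiable (by simp) x), hdφe, divergence_smul_add_const, real_inner_smul_right]
  ring

end Divergence

section Gaussian

lemma three_quarters_norm_sq_sub_le {F : Type*} [SeminormedAddCommGroup F] {x₀ : F} {ρ : ℝ}
    (hx₀ : ‖x₀‖ ≤ ρ) (x : F) :
    3 / 4 * ‖x‖ ^ 2 - 4 * ρ ^ 2 ≤ ‖x - x₀‖ ^ 2 := by
  have htri : ‖x‖ ^ 2 ≤ (‖x - x₀‖ + ‖x₀‖) ^ 2 :=
    pow_le_pow_left₀ (norm_nonneg _) (by linarith [norm_sub_norm_le x x₀]) 2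
  have hρ : ‖x₀‖ ^ 2 ≤ ρ ^ 2 := pow_le_pow_left₀ (norm_nonneg _) hx₀ 2
  nlinarith [sq_nonneg (‖x - x₀‖ - 3 * ‖x₀‖)]

lemma norm_sub_norm_sub_sq_div_le {F : Type*} [SeminormedAddCommGroup F] {t₁ t t₂ ρ : ℝ}
    (h₁ : 0 < t₁) (ht₁ : t₁ ≤ t) (ht₂ : t ≤ t₂) {x₀ : F} (hx₀ : ‖x₀‖ ≤ ρ) (x : F) :
    ‖x‖ - ‖x - x₀‖ ^ 2 / (4 * t) ≤ ρ ^ 2 / t₁ + 4 * t₂ - ‖x‖ ^ 2 / (4 * (2 * t₂)) := by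
  have ht : 0 < t := h₁.trans_le ht₁
  have h₂ : 0 < t₂ := ht.trans_le ht₂
  have hx : ‖x‖ ≤ ‖x‖ ^ 2 / (16 * t₂) + 4 * t₂ := by
    have : ‖x‖ ^ 2 / (16 * t₂) + 4 * t₂ - ‖x‖ = (‖x‖ - 8 * t₂) ^ 2 / (16 * t₂) := by
      field_simp; ring
    have : 0 ≤ (‖x‖ - 8 * t₂) ^ 2 / (16 * t₂) := by positivity
    linarith
  have hdist : 3 / 16 * ‖x‖ ^ 2 / t₂ - ρ ^ 2 / t₁ ≤ ‖x - x₀‖ ^ 2 / (4 * t) :=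
    calc 3 / 16 * ‖x‖ ^ 2 / t₂ - ρ ^ 2 / t₁ ≤ 3 / 16 * ‖x‖ ^ 2 / t - ρ ^ 2 / t := by gcongr
      _ = (3 / 4 * ‖x‖ ^ 2 - 4 * ρ ^ 2) / (4 * t) := by field_simp; ring
      _ ≤ ‖x - x₀‖ ^ 2 / (4 * t) := by gcongr; exact three_quarters_norm_sq_sub_le hx₀ x
  have hsplit : ‖x‖ ^ 2 / (4 * (2 * t₂)) = 3 / 16 * ‖x‖ ^ 2 / t₂ - ‖x‖ ^ 2 / (16 * t₂) := by
    field_simp; ring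
  linarith

variable {E : Type*} [NormedAddCommGroup E] [InnerProductSpace ℝ E]

/-- The backward heat kernel at time distance `t`, centred at `x₀`. -/
def gauss (x₀ : E) (t : ℝ) (x : E) : ℝ :=
  Real.exp (-‖x - x₀‖ ^ 2 / (4 * t)) / (4 * Real.pi * t) ^ ((Module.finrank ℝ E : ℝ) / 2)

lemma gauss_pos (x₀ : E) {t : ℝ} (ht : 0 < t) (x : E) : 0 < gauss x₀ t x := by
  unfold gauss; positivity

lemma gauss_le (x₀ : E) {t : ℝ} (ht : 0 < t) (x : E) :
    gauss x₀ t x ≤ ((4 * Real.pi * t) ^ ((Module.finrank ℝ E : ℝ) / 2))⁻¹ := by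
  rw [gauss, div_eq_mul_inv]
  refine mul_le_of_le_one_left (by positivity) (Real.exp_le_one_iff.2 ?_)
  exact div_nonpos_of_nonpos_of_nonneg (neg_nonpos.2 (sq_nonneg _)) (by positivity)

lemma continuousAt_gauss {X : Type*} [TopologicalSpace X] {x₀ x : X → E} {t : X → ℝ} {z : X}
    (hx₀ : ContinuousAt x₀ z) (ht : ContinuousAt t z) (hx : ContinuousAt x z) (htz : 0 < t z) :
    ContinuousAt (fun z => gauss (x₀ z) (t z) (x z)) z := by
  unfold gauss
  refine ContinuousAt.div (ContinuousAt.rexp (ContinuousAt.div (by fun_prop) (by fun_prop) ?_))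
    (ContinuousAt.rpow_const (by fun_prop) (Or.inl ?_)) ?_ <;> positivity

lemma contDiff_gauss {k : WithTop ℕ∞} (x₀ : E) (t : ℝ) : ContDiff ℝ k (gauss x₀ t) :=
  (((contDiff_id.sub contDiff_const).norm_sq ℝ).neg.div_const _).exp.div_const _

@[fun_prop]
lemma continuous_gauss (x₀ : E) (t : ℝ) : Continuous (gauss x₀ t) :=
  (contDiff_gauss (k := 0) x₀ t).continuous

lemma fderiv_gauss (x₀ : E) (t : ℝ) (x v : E) :
    fderiv ℝ (gauss x₀ t) x v = -(gauss x₀ t x * ⟪x - x₀, v⟫_ℝ / (2 * t)) := by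
  have hsq : HasFDerivAt (fun x => ‖x - x₀‖ ^ 2) (2 • innerSL ℝ (x - x₀)) x := by
    simpa using ((hasFDerivAt_id x).sub_const x₀).norm_sq
  have hG : HasFDerivAt (gauss x₀ t) _ x := (hsq.fun_neg.mul_const (4 * t)⁻¹).exp.mul_const
    ((4 * Real.pi * t) ^ ((Module.finrank ℝ E : ℝ) / 2))⁻¹
  rw [hG.fderiv]
  simp only [gauss, smul_apply, neg_apply, innerSL_apply_apply, smul_eq_mul, nsmul_eq_mul,
    div_eq_mul_inv]
  push_cast
  ring

lemma hasDerivAt_mul_gauss_path (y x : E) (a σ : ℝ) (ht : 0 < 1 + a * σ ^ 2) :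
    HasDerivAt (fun σ : ℝ => (1 + a * σ ^ 2) * gauss (σ • y) (1 + a * σ ^ 2) x)
      (gauss (σ • y) (1 + a * σ ^ 2) x * (a * σ * (2 - Module.finrank ℝ E) +
        ⟪x - σ • y, (a * σ) • x + y⟫_ℝ / (2 * (1 + a * σ ^ 2)))) σ := by
  have hT : HasDerivAt (fun σ : ℝ => 1 + a * σ ^ 2) (2 * (a * σ)) σ :=
    (((hasDerivAt_pow 2 σ).const_mul a).const_add 1).congr_deriv (by push_cast; ring)
  have hN : HasDerivAt (fun σ : ℝ => ‖x - σ • y‖ ^ 2) (2 * ⟪x - σ • y, -y⟫_ℝ) σ := by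
    simpa using (((hasDerivAt_id σ).smul_const y).const_sub x).norm_sq
  have hE := (hN.fun_neg.fun_div (hT.const_mul 4) (by positivity)).exp
  have hP := (hT.const_mul (4 * Real.pi)).rpow_const (p := (Module.finrank ℝ E : ℝ) / 2)
    (Or.inl (by positivity))
  refine (hT.fun_mul (hE.fun_div hP (by positivity))).congr_deriv ?_
  have hinner : ⟪x - σ • y, (a * σ) • x + y⟫_ℝ =
      a * σ * ‖x - σ • y‖ ^ 2 + (1 + a * σ ^ 2) * ⟪x - σ • y, y⟫_ℝ := by
    rw [← real_inner_self_eq_norm_sq, inner_sub_right (x - σ • y) x]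
    simp only [inner_add_right, real_inner_smul_right]
    ring
  have hQ : 0 < (4 * Real.pi * (1 + a * σ ^ 2)) ^ ((Module.finrank ℝ E : ℝ) / 2) := by positivity
  rw [Real.rpow_sub_one (by positivity), hinner, inner_neg_right, gauss]
  generalize (4 * Real.pi * (1 + a * σ ^ 2)) ^ ((Module.finrank ℝ E : ℝ) / 2) = Q at hQ ⊢
  generalize 1 + a * σ ^ 2 = t at ht ⊢
  have := Real.pi_pos
  field_simp
  ring

section Integral

variable [FiniteDimensional ℝ E] [MeasurableSpace E] [BorelSpace E]

lemma integral_gauss (x₀ : E) {t : ℝ} (ht : 0 < t) : ∫ x, gauss x₀ t x = 1 := by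
  have hcentre : ∫ x : E, Real.exp (-‖x - x₀‖ ^ 2 / (4 * t)) =
      ∫ x : E, Real.exp (-(4 * t)⁻¹ * ‖x‖ ^ 2) := by
    rw [← integral_sub_right_eq_self (fun x : E => Real.exp (-(4 * t)⁻¹ * ‖x‖ ^ 2)) x₀]
    simp only [div_eq_mul_inv, neg_mul, mul_comm (4 * t)⁻¹]
  simp only [gauss]
  rw [integral_div, hcentre, GaussianFourier.integral_rexp_neg_mul_sq_norm (by positivity),
    div_inv_eq_mul, show Real.pi * (4 * t) = 4 * Real.pi * t by ring]
  exact div_self (by positivity)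

lemma integrable_gauss (x₀ : E) {t : ℝ} (ht : 0 < t) : Integrable (gauss x₀ t) :=
  Integrable.of_integral_ne_zero (by rw [integral_gauss x₀ ht]; exact one_ne_zero)

end Integral

lemma exists_gauss_dominated (E : Type*) [NormedAddCommGroup E] [InnerProductSpace ℝ E]
    {t₁ t₂ : ℝ} (h₁ : 0 < t₁) (h₂ : 0 < t₂) (ρ : ℝ) :
    ∃ C : ℝ, 0 < C ∧ ∀ (x₀ : E) (t : ℝ), ‖x₀‖ ≤ ρ → t₁ ≤ t → t ≤ t₂ → ∀ x : E,
      (1 + ‖x‖) * gauss x₀ t x ≤ C * gauss 0 (2 * t₂) x := by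
  let d : ℝ := (Module.finrank ℝ E : ℝ) / 2
  refine ⟨Real.exp (ρ ^ 2 / t₁ + 4 * t₂) * ((4 * Real.pi * (2 * t₂)) ^ d /
    (4 * Real.pi * t₁) ^ d), by positivity, fun x₀ t hx₀ ht₁ ht₂ x => ?_⟩
  have hexp : (1 + ‖x‖) * Real.exp (-‖x - x₀‖ ^ 2 / (4 * t)) ≤
      Real.exp (ρ ^ 2 / t₁ + 4 * t₂) * Real.exp (-‖x‖ ^ 2 / (4 * (2 * t₂))) :=
    calc _ ≤ Real.exp ‖x‖ * Real.exp (-‖x - x₀‖ ^ 2 / (4 * t)) := by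
          gcongr; linarith [Real.add_one_le_exp ‖x‖]
      _ ≤ _ := by
          rw [← Real.exp_add, ← Real.exp_add, Real.exp_le_exp, neg_div, neg_div]
          exact norm_sub_norm_sub_sq_div_le h₁ ht₁ ht₂ hx₀ x
  calc (1 + ‖x‖) * gauss x₀ t x
      = (1 + ‖x‖) * Real.exp (-‖x - x₀‖ ^ 2 / (4 * t)) / (4 * Real.pi * t) ^ d :=
        (mul_div_assoc _ _ _).symm
    _ ≤ (Real.exp (ρ ^ 2 / t₁ + 4 * t₂) * Real.exp (-‖x‖ ^ 2 / (4 * (2 * t₂)))) /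
          (4 * Real.pi * t₁) ^ d := by gcongr
    _ = _ := by
        have : (4 * Real.pi * (2 * t₂)) ^ d ≠ 0 := by positivity
        rw [gauss, sub_zero, ← show d = Module.finrank ℝ E / 2 from rfl]
        field_simp

end Gaussian

section Cutoff

variable {E : Type*} [NormedAddCommGroup E] [InnerProductSpace ℝ E]

/-- A smooth cutoff function, equal to `1` on the ball of radius `R` and to `0` outside the ball of
radius `2 * R`. -/
def cutoff (R : ℝ) (x : E) : ℝ :=
  (⟨1, 2, one_pos, one_lt_two⟩ : ContDiffBump (0 : E)) (R⁻¹ • x)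

lemma contDiff_cutoff {k : ℕ∞} (R : ℝ) : ContDiff ℝ k (cutoff R : E → ℝ) :=
  (ContDiffBump.contDiff _).comp (contDiff_const_smul R⁻¹)

lemma cutoff_nonneg (R : ℝ) (x : E) : 0 ≤ cutoff R x := ContDiffBump.nonneg _

lemma cutoff_le_one (R : ℝ) (x : E) : cutoff R x ≤ 1 := ContDiffBump.le_one _

lemma cutoff_eq_one {R : ℝ} (hR : 0 < R) {x : E} (hx : ‖x‖ ≤ R) : cutoff R x = 1 := by
  refine ContDiffBump.one_of_mem_closedBall _ ?_
  rwa [mem_closedBall_zero_iff, norm_smul, norm_inv, Real.norm_of_nonneg hR.le, inv_mul_le_one₀ hR]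

lemma cutoff_eq_zero {R : ℝ} (hR : 0 < R) {x : E} (hx : 2 * R ≤ ‖x‖) : cutoff R x = 0 := by
  refine ContDiffBump.zero_of_le_dist _ ?_
  rwa [dist_zero_right, norm_smul, norm_inv, Real.norm_of_nonneg hR.le, le_inv_mul_iff₀ hR,
    mul_comm]

variable [FiniteDimensional ℝ E]

lemma hasCompactSupport_cutoff {R : ℝ} (hR : 0 < R) : HasCompactSupport (cutoff R : E → ℝ) :=
  HasCompactSupport.intro (isCompact_closedBall (0 : E) (2 * R)) fun x hx =>
    cutoff_eq_zero hR (by simpa using (not_le.1 (mem_closedBall_zero_iff.not.1 hx)).le)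

lemma exists_norm_fderiv_cutoff_le (E : Type*) [NormedAddCommGroup E] [InnerProductSpace ℝ E]
    [FiniteDimensional ℝ E] : ∃ C : ℝ, 0 ≤ C ∧ ∀ R : ℝ, 0 < R → ∀ x : E,
      ‖fderiv ℝ (cutoff R) x‖ ≤ C / R := by
  let b : ContDiffBump (0 : E) := ⟨1, 2, one_pos, one_lt_two⟩
  obtain ⟨C, hC⟩ := (b.hasCompactSupport.fderiv (𝕜 := ℝ)).exists_bound_of_continuous
    ((b.contDiff (n := 1)).continuous_fderiv (by simp))
  refine ⟨C, (norm_nonneg _).trans (hC 0), fun R hR x => ?_⟩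
  rw [show cutoff R = fun x => b (R⁻¹ • x) from rfl, fderiv_comp_smul, norm_smul, norm_inv,
    Real.norm_of_nonneg hR.le, inv_mul_eq_div]
  gcongr
  exact hC _

section Integral

variable [MeasurableSpace E] [BorelSpace E]

lemma integrable_of_eq_zero_off_tsupport {F : Type*} [Zero F] {χ : E → F} {h : E → ℝ}
    (hc : HasCompactSupport χ) (hh : Continuous h) (h0 : ∀ x ∉ tsupport χ, h x = 0) :
    Integrable h :=
  hh.integrable_of_hasCompactSupport (HasCompactSupport.intro hc h0)

lemma tendsto_integral_cutoff_pow_mul (j : ℕ) {h : E → ℝ} (hh : Integrable h) :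
    Tendsto (fun k : ℕ => ∫ x, cutoff (k : ℝ) x ^ j * h x) atTop (𝓝 (∫ x, h x)) := by
  refine tendsto_integral_of_dominated_convergence (fun x => ‖h x‖)
    (fun k => ((contDiff_cutoff (k := 0) k).continuous.pow j).aestronglyMeasurable.mul
      hh.aestronglyMeasurable) hh.norm
    (fun k => Eventually.of_forall fun x => ?_) (Eventually.of_forall fun x => ?_)
  · rw [norm_mul, Real.norm_of_nonneg (pow_nonneg (cutoff_nonneg _ _) j)]
    exact mul_le_of_le_one_left (norm_nonneg _)
      (pow_le_one₀ (cutoff_nonneg _ _) (cutoff_le_one _ _))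
  · refine tendsto_const_nhds.congr' ?_
    filter_upwards [tendsto_natCast_atTop_atTop.eventually_gt_atTop ‖x‖] with k hk
    rw [cutoff_eq_one ((norm_nonneg x).trans_lt hk) hk.le, one_pow, one_mul]

lemma hasDerivAt_integral_mul_of_hasCompactSupport {g : E → ℝ} (hg : Continuous g)
    (hc : HasCompactSupport g) {U : Set ℝ} (hU : IsOpen U) {Φ Φ' : ℝ → E → ℝ}
    (hΦ : ∀ s ∈ U, Continuous (Φ s)) (hΦ' : ContinuousOn (Function.uncurry Φ') (U ×ˢ univ))
    (hder : ∀ s ∈ U, ∀ x, HasDerivAt (fun s => Φ s x) (Φ' s x) s) {σ : ℝ} (hσ : σ ∈ U) :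
    HasDerivAt (fun s => ∫ x, g x * Φ s x) (∫ x, g x * Φ' σ x) σ := by
  obtain ⟨δ, hδ, hδU⟩ := Metric.nhds_basis_closedBall.mem_iff.1 (hU.mem_nhds hσ)
  have hsub : Metric.closedBall σ δ ×ˢ tsupport g ⊆ U ×ˢ univ := prod_mono hδU (subset_univ _)
  obtain ⟨C, hC⟩ := ((isCompact_closedBall σ δ).prod hc).exists_bound_of_continuousOn
    ((hg.comp continuous_snd).continuousOn.mul (hΦ'.mono hsub))
  have hΦ'σ : Continuous (Φ' σ) := continuousOn_univ.1 <|
    hΦ'.comp (f := fun x => (σ, x)) (by fun_prop) fun x _ => ⟨hσ, mem_univ x⟩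
  refine (hasDerivAt_integral_of_dominated_loc_of_deriv_le (F := fun s x => g x * Φ s x)
    (F' := fun s x => g x * Φ' s x) (bound := (tsupport g).indicator fun _ => C)
    (Metric.closedBall_mem_nhds σ hδ) ?_ ?_ (hg.mul hΦ'σ).aestronglyMeasurable ?_ ?_ ?_).2
  · filter_upwards [hU.mem_nhds hσ] with s hs
    exact (hg.mul (hΦ s hs)).aestronglyMeasurable
  · exact integrable_of_eq_zero_off_tsupport hc (hg.mul (hΦ σ hσ)) fun x hx => by
      simp [image_eq_zero_of_notMem_tsupport hx]
  · refine Eventually.of_forall fun x s hs => ?_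
    by_cases hx : x ∈ tsupport g
    · rw [indicator_of_mem hx]
      exact hC (s, x) ⟨hs, hx⟩
    · rw [indicator_of_notMem hx, image_eq_zero_of_notMem_tsupport hx, zero_mul, norm_zero]
  · rw [integrable_indicator_iff (isClosed_tsupport g).measurableSet]
    exact integrableOn_const hc.measure_lt_top.ne
  · exact Eventually.of_forall fun x s hs => (hder s (hδU hs) x).const_mul _

end Integral

end Cutoff

section Energy

/-- The Gaussian weighted energy `(t/2) ∫ e G_{x₀,t}` of an energy density `e`, the real valued
counterpart of `functionalF`. -/
def gaussEnergy {E : Type*} [NormedAddCommGroup E] [InnerProductSpace ℝ E] [MeasureSpace E]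
    (e : E → ℝ) (x₀ : E) (t : ℝ) : ℝ := t / 2 * ∫ x, e x * gauss x₀ t x

variable {m n : ℕ}

lemma contDiff_ambient {f : Euc m → Sph n} (hf : IsSmooth f) : ContDiff ℝ ∞ (ambient f) :=
  have : Fact (Module.finrank ℝ (Euc (n + 1)) = n + 1) := ⟨by simp⟩
  ContMDiff.contDiff ((contMDiff_coe_sphere (m := ∞) (E := Euc (n + 1)) (n := n)).comp hf)

lemma continuous_energyDensity_ambient {f : Euc m → Sph n} (hf : IsSmooth f) :
    Continuous (energyDensity (ambient f)) :=
  (contDiff_energyDensity (l := 0) (contDiff_ambient hf)).continuous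

lemma functionalF_eq_lintegral (f : Euc m → Sph n) (x₀ : Euc m) (t : ℝ) :
    functionalF x₀ t f = ENNReal.ofReal (t / 2) *
      ∫⁻ x, ENNReal.ofReal (energyDensity (ambient f) x * gauss x₀ t x) := by
  simp only [functionalF, normSqT, gauss, finrank_euclideanSpace_fin,
    energyDensity_eq_sum_norm_sq (EuclideanSpace.basisFun (Fin m) ℝ),
    EuclideanSpace.basisFun_apply]

lemma functionalF_le_ofReal {f : Euc m → Sph n} {x₀ : Euc m} {t : ℝ} (ht : 0 < t) {h : Euc m → ℝ}
    (hle : ∀ x, energyDensity (ambient f) x ≤ h x)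
    (hi : Integrable (fun x => h x * gauss x₀ t x)) :
    functionalF x₀ t f ≤ ENNReal.ofReal (gaussEnergy h x₀ t) := by
  rw [functionalF_eq_lintegral, gaussEnergy, ENNReal.ofReal_mul (by positivity),
    ofReal_integral_eq_lintegral_ofReal hi (Eventually.of_forall fun x =>
      mul_nonneg ((energyDensity_nonneg _ _).trans (hle x)) (gauss_pos x₀ ht x).le)]
  gcongr with x
  · exact (gauss_pos x₀ ht x).le
  · exact hle x

lemma functionalF_eq_ofReal {f : Euc m → Sph n} {x₀ : Euc m} {t : ℝ} (ht : 0 < t)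
    (hi : Integrable (fun x => energyDensity (ambient f) x * gauss x₀ t x)) :
    functionalF x₀ t f = ENNReal.ofReal (gaussEnergy (energyDensity (ambient f)) x₀ t) := by
  rw [functionalF_eq_lintegral, gaussEnergy, ENNReal.ofReal_mul (by positivity),
    ofReal_integral_eq_lintegral_ofReal hi (Eventually.of_forall fun x =>
      mul_nonneg (energyDensity_nonneg _ _) (gauss_pos x₀ ht x).le)]

lemma functionalF_le_entropy (f : Euc m → Sph n) (x₀ : Euc m) {t : ℝ} (ht : 0 < t) :
    functionalF x₀ t f ≤ entropy f :=
  le_iSup₂_of_le x₀ t (le_iSup_of_le ht le_rfl)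

lemma integrable_energyDensity_mul_gauss {f : Euc m → Sph n} (hf : IsSmooth f)
    (hfin : entropy f ≠ ⊤) (x₀ : Euc m) {t : ℝ} (ht : 0 < t) :
    Integrable (fun x => energyDensity (ambient f) x * gauss x₀ t x) := by
  have hF := ne_top_of_le_ne_top hfin (functionalF_le_entropy f x₀ ht)
  rw [functionalF_eq_lintegral] at hF
  refine ⟨((continuous_energyDensity_ambient hf).mul
    (continuous_gauss x₀ t)).aestronglyMeasurable, ?_⟩
  rw [hasFiniteIntegral_iff_ofReal (Eventually.of_forall fun x =>
    mul_nonneg (energyDensity_nonneg _ _) (gauss_pos x₀ ht x).le)]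
  refine lt_top_iff_ne_top.2 fun h => hF ?_
  rw [h, ENNReal.mul_top (by simpa using ht)]

end Energy

section Monotonicity

variable {E H : Type*} [NormedAddCommGroup E] [InnerProductSpace ℝ E]
  [NormedAddCommGroup H] [InnerProductSpace ℝ H]

/-- The square of the velocity of `u` along the parabolic path `σ ↦ (σ y, 1 + a σ²)`, weighted by
the Gaussian. -/
def pathDissipation (u : E → H) (y : E) (a σ : ℝ) (x : E) : ℝ :=
  gauss (σ • y) (1 + a * σ ^ 2) x * ‖fderiv ℝ u x ((a * σ) • x + y)‖ ^ 2

lemma continuous_pathDissipation {u : E → H} (hu : ContDiff ℝ 1 u) (y : E) (a σ : ℝ) :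
    Continuous (pathDissipation u y a σ) := by
  have := hu.continuous_fderiv (by simp)
  unfold pathDissipation
  fun_prop

lemma pathDissipation_nonneg (u : E → H) (y : E) {a σ : ℝ} (ht : 0 < 1 + a * σ ^ 2) (x : E) :
    0 ≤ pathDissipation u y a σ x :=
  mul_nonneg (gauss_pos _ ht x).le (sq_nonneg _)

variable [FiniteDimensional ℝ E]

/-- The soliton equation `τ(u) = (x/2) ⌟ Tu` tested against the image of `Tu`. For maps into a
submanifold the normal part of the Laplacian drops out, so that this makes sense for maps into a
vector space. -/
def SatisfiesSolitonEquation (u : E → H) : Prop :=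
  ∀ x v, ⟪Laplacian.laplacian u x, fderiv ℝ u x v⟫_ℝ =
    ⟪fderiv ℝ u x ((1 / 2 : ℝ) • x), fderiv ℝ u x v⟫_ℝ

lemma abs_inner_fderiv_le (u : E → H) (x v w : E) :
    |⟪fderiv ℝ u x v, fderiv ℝ u x w⟫_ℝ| ≤ energyDensity u x * (‖v‖ * ‖w‖) := by
  refine (abs_real_inner_le_norm _ _).trans (abs_le_of_sq_le_sq' ?_ (mul_nonneg
    (energyDensity_nonneg u x) (by positivity))).2
  calc (‖fderiv ℝ u x v‖ * ‖fderiv ℝ u x w‖) ^ 2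
      = ‖fderiv ℝ u x v‖ ^ 2 * ‖fderiv ℝ u x w‖ ^ 2 := mul_pow _ _ _
    _ ≤ energyDensity u x * ‖v‖ ^ 2 * (energyDensity u x * ‖w‖ ^ 2) :=
        mul_le_mul (norm_fderiv_apply_sq_le u x v) (norm_fderiv_apply_sq_le u x w)
          (sq_nonneg _) (mul_nonneg (energyDensity_nonneg u x) (sq_nonneg _))
    _ = (energyDensity u x * (‖v‖ * ‖w‖)) ^ 2 := by ring

lemma norm_gradient (φ : E → ℝ) (x : E) : ‖gradient φ x‖ = ‖fderiv ℝ φ x‖ :=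
  LinearIsometryEquiv.norm_map _ _

lemma continuous_gradient {φ : E → ℝ} (hφ : ContDiff ℝ 1 φ) : Continuous (gradient φ) :=
  (LinearIsometryEquiv.continuous _).comp (hφ.continuous_fderiv (by simp))

lemma gradient_mul_gauss {χ : E → ℝ} {x : E} (hχ : DifferentiableAt ℝ χ x) (x₀ : E) (t : ℝ) :
    gradient (fun y => χ y * gauss x₀ t y) x =
      gauss x₀ t x • gradient χ x - (χ x * gauss x₀ t x / (2 * t)) • (x - x₀) := by
  refine ext_inner_right ℝ fun v => ?_
  rw [inner_gradient_left, fderiv_fun_mul hχ ((contDiff_gauss (k := 1) x₀ t).differentiable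
    (by simp) x), inner_sub_left, real_inner_smul_left, real_inner_smul_left, inner_gradient_left,
    add_apply, smul_apply, smul_apply, fderiv_gauss, smul_eq_mul, smul_eq_mul]
  ring

/-- The part of the derivative of the Gaussian energy along the path `σ ↦ (σ y, 1 + a σ²)` that is
due to the cutoff `χ`. -/
def cutoffError (u : E → H) (χ : E → ℝ) (y : E) (a σ : ℝ) (x : E) : ℝ :=
  gauss (σ • y) (1 + a * σ ^ 2) x * (2⁻¹ * energyDensity u x * fderiv ℝ χ x ((a * σ) • x + y) -
    ⟪fderiv ℝ u x (gradient χ x), fderiv ℝ u x ((a * σ) • x + y)⟫_ℝ)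

lemma continuous_cutoffError {u : E → H} (hu : ContDiff ℝ 1 u) {χ : E → ℝ} (hχ : ContDiff ℝ 1 χ)
    (y : E) (a σ : ℝ) : Continuous (cutoffError u χ y a σ) := by
  have := hu.continuous_fderiv (by simp)
  have := hχ.continuous_fderiv (by simp)
  have := continuous_gradient hχ
  have := (contDiff_energyDensity (l := 0) hu).continuous
  unfold cutoffError
  fun_prop

/-- With `Y x = (a σ) x + y` and `t = 1 + a σ²`, the decomposition
`x / 2 = (σ / (2 t)) Y x + (x - σ y) / (2 t)` matches the drift in the soliton equation with the
logarithmic gradient of the Gaussian. -/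
lemma SatisfiesSolitonEquation.inner_laplacian_path {u : E → H} (hsol : SatisfiesSolitonEquation u)
    (y : E) {a σ : ℝ} (ht : 0 < 1 + a * σ ^ 2) (x : E) :
    ⟪Laplacian.laplacian u x, fderiv ℝ u x ((a * σ) • x + y)⟫_ℝ =
      σ / (2 * (1 + a * σ ^ 2)) * ‖fderiv ℝ u x ((a * σ) • x + y)‖ ^ 2 +
      (2 * (1 + a * σ ^ 2))⁻¹ *
        ⟪fderiv ℝ u x (x - σ • y), fderiv ℝ u x ((a * σ) • x + y)⟫_ℝ := by
  have hvec : (1 / 2 : ℝ) • x = (σ / (2 * (1 + a * σ ^ 2))) • ((a * σ) • x + y) +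
      (2 * (1 + a * σ ^ 2))⁻¹ • (x - σ • y) := by
    have hx : σ / (2 * (1 + a * σ ^ 2)) * (a * σ) + (2 * (1 + a * σ ^ 2))⁻¹ = 1 / 2 := by
      rw [div_mul_eq_mul_div, inv_eq_one_div, ← add_div, div_eq_iff (by positivity)]
      ring
    rw [← hx]
    module
  rw [hsol, hvec, map_add, map_smul, map_smul, inner_add_left, real_inner_smul_left,
    real_inner_smul_left, real_inner_self_eq_norm_sq]

variable [MeasurableSpace E] [BorelSpace E]

/-- The Pohozaev identity for `φ = χ G` and `Y x = (a σ) x + y`. -/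
lemma SatisfiesSolitonEquation.integral_cutoff_path {u : E → H} (hsol : SatisfiesSolitonEquation u)
    (hu : ContDiff ℝ 2 u) {χ : E → ℝ} (hχ : ContDiff ℝ 1 χ) (hc : HasCompactSupport χ) (y : E)
    {a σ : ℝ} (ht : 0 < 1 + a * σ ^ 2) :
    2⁻¹ * (∫ x, χ x * energyDensity u x * (gauss (σ • y) (1 + a * σ ^ 2) x *
      (a * σ * (2 - Module.finrank ℝ E) +
        ⟪x - σ • y, (a * σ) • x + y⟫_ℝ / (2 * (1 + a * σ ^ 2))))) =
    (∫ x, cutoffError u χ y a σ x) -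
      σ / (2 * (1 + a * σ ^ 2)) * ∫ x, χ x * pathDissipation u y a σ x := by
  have hu₁ : ContDiff ℝ 1 u := hu.of_le (by norm_num)
  have := (contDiff_energyDensity (l := 0) hu₁).continuous
  have hpath : Integrable fun x => 2⁻¹ * (χ x * energyDensity u x *
      (gauss (σ • y) (1 + a * σ ^ 2) x * (a * σ * (2 - Module.finrank ℝ E) +
        ⟪x - σ • y, (a * σ) • x + y⟫_ℝ / (2 * (1 + a * σ ^ 2))))) :=
    integrable_of_eq_zero_off_tsupport hc (by fun_prop) fun x hx => by
      simp [image_eq_zero_of_notMem_tsupport hx]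
  have herr : Integrable (cutoffError u χ y a σ) :=
    integrable_of_eq_zero_off_tsupport hc (continuous_cutoffError hu₁ hχ y a σ) fun x hx => by
      simp [cutoffError, gradient, fderiv_of_notMem_tsupport (𝕜 := ℝ) hx]
  have hdis : Integrable fun x =>
      σ / (2 * (1 + a * σ ^ 2)) * (χ x * pathDissipation u y a σ x) :=
    integrable_of_eq_zero_off_tsupport hc (continuous_const.mul
      (hχ.continuous.mul (continuous_pathDissipation hu₁ y a σ))) fun x hx => by
        simp [image_eq_zero_of_notMem_tsupport hx]
  rw [← integral_const_mul, ← integral_const_mul, ← integral_sub herr hdis]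
  refine sub_eq_zero.1 ((integral_sub hpath (herr.sub hdis)).symm.trans ?_)
  rw [← integral_pohozaev hu (hχ.mul (contDiff_gauss (σ • y) (1 + a * σ ^ 2))) hc.mul_right
    (a * σ) y]
  refine integral_congr_ae (Eventually.of_forall fun x => ?_)
  have hgrad := gradient_mul_gauss (hχ.differentiable (by simp) x) (σ • y) (1 + a * σ ^ 2)
  have hfderiv := congrArg (⟪·, (a * σ) • x + y⟫_ℝ) hgrad
  simp only [inner_gradient_left, inner_sub_left, real_inner_smul_left] at hfderiv
  simp only [Pi.sub_apply, hfderiv, hgrad, hsol.inner_laplacian_path y ht, map_sub,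
    map_smul, inner_sub_left, real_inner_smul_left, cutoffError, pathDissipation]
  ring

end Monotonicity

section MonotonicityFormula

lemma path_time_bounds {a σ : ℝ} (hσ : σ ∈ Icc (0 : ℝ) 1) :
    min 1 (1 + a) ≤ 1 + a * σ ^ 2 ∧ 1 + a * σ ^ 2 ≤ max 1 (1 + a) := by
  have hsq : σ ^ 2 ≤ 1 := pow_le_one₀ hσ.1 hσ.2
  rcases le_total 0 a with ha | ha
  · rw [min_eq_left (by linarith), max_eq_right (by linarith)]
    constructor <;> nlinarith [sq_nonneg σ]
  · rw [min_eq_right (by linarith), max_eq_left (by linarith)]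
    constructor <;> nlinarith [sq_nonneg σ]

lemma path_time_pos {a σ : ℝ} (ha : -1 < a) (hσ : σ ∈ Icc (0 : ℝ) 1) : 0 < 1 + a * σ ^ 2 :=
  (lt_min one_pos (by linarith)).trans_le (path_time_bounds hσ).1

lemma norm_smul_add_le {F : Type*} [SeminormedAddCommGroup F] [NormedSpace ℝ F] (y x : F) (a : ℝ)
    {σ : ℝ} (hσ : σ ∈ Icc (0 : ℝ) 1) : ‖(a * σ) • x + y‖ ≤ (|a| + ‖y‖) * (1 + ‖x‖) := by
  have hle : ‖(a * σ) • x + y‖ ≤ |a| * ‖x‖ + ‖y‖ := by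
    refine (norm_add_le _ _).trans ?_
    rw [norm_smul, Real.norm_eq_abs, abs_mul, abs_of_nonneg hσ.1]
    gcongr
    exact mul_le_of_le_one_right (abs_nonneg a) hσ.2
  nlinarith [abs_nonneg a, norm_nonneg y, norm_nonneg x]

variable {E H : Type*} [NormedAddCommGroup E] [InnerProductSpace ℝ E] [FiniteDimensional ℝ E]
  [NormedAddCommGroup H] [InnerProductSpace ℝ H]

lemma norm_cutoffError_le (u : E → H) (χ : E → ℝ) (y : E) {a σ : ℝ} (ht : 0 < 1 + a * σ ^ 2)
    (x : E) : ‖cutoffError u χ y a σ x‖ ≤ gauss (σ • y) (1 + a * σ ^ 2) x *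
      (3 / 2 * energyDensity u x * (‖fderiv ℝ χ x‖ * ‖(a * σ) • x + y‖)) := by
  have he := energyDensity_nonneg u x
  have hdir : ‖2⁻¹ * energyDensity u x * fderiv ℝ χ x ((a * σ) • x + y)‖ ≤
      2⁻¹ * energyDensity u x * (‖fderiv ℝ χ x‖ * ‖(a * σ) • x + y‖) := by
    rw [norm_mul, Real.norm_of_nonneg (by positivity)]
    gcongr
    exact ContinuousLinearMap.le_opNorm _ _
  have hgrad := abs_inner_fderiv_le u x (gradient χ x) ((a * σ) • x + y)
  rw [norm_gradient, ← Real.norm_eq_abs] at hgrad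
  rw [cutoffError, norm_mul, Real.norm_of_nonneg (gauss_pos _ ht x).le]
  gcongr
  · exact (gauss_pos _ ht x).le
  · linarith [norm_sub_le (2⁻¹ * energyDensity u x * fderiv ℝ χ x ((a * σ) • x + y))
      ⟪fderiv ℝ u x (gradient χ x), fderiv ℝ u x ((a * σ) • x + y)⟫_ℝ]

variable [MeasurableSpace E] [BorelSpace E]

/-- All Gaussian weighted energies of `u` are finite. -/
def HasFiniteGaussEnergies (u : E → H) : Prop :=
  ∀ (x₀ : E) {t : ℝ}, 0 < t → Integrable (fun x => energyDensity u x * gauss x₀ t x)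

lemma HasFiniteGaussEnergies.exists_integral_cutoffError_le {u : E → H}
    (hfin : HasFiniteGaussEnergies u) (y : E) {a : ℝ} (ha : -1 < a) :
    ∃ C : ℝ, ∀ R : ℝ, 0 < R → ∀ σ ∈ Icc (0 : ℝ) 1,
      ∫ x, cutoffError u (cutoff R) y a σ x ≤ C / R := by
  obtain ⟨C₁, hC₁, hcut⟩ := exists_norm_fderiv_cutoff_le E
  have htmin : 0 < min 1 (1 + a) := lt_min one_pos (by linarith)
  have htmax : 0 < max 1 (1 + a) := lt_max_of_lt_left one_pos
  obtain ⟨C₂, _hC₂, hdom⟩ := exists_gauss_dominated E htmin htmax ‖y‖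
  let T := 2 * max 1 (1 + a)
  let L : ℝ := 3 / 2 * (|a| + ‖y‖) * C₁ * C₂
  refine ⟨L * ∫ x, energyDensity u x * gauss 0 T x, fun R hR σ hσ => ?_⟩
  rw [mul_div_right_comm, ← integral_const_mul]
  refine (Real.le_norm_self _).trans (norm_integral_le_of_norm_le
    ((hfin 0 (mul_pos two_pos htmax)).const_mul (L / R)) (Eventually.of_forall fun x => ?_))
  obtain ⟨ht₁, ht₂⟩ := path_time_bounds (a := a) hσ
  have ht : 0 < 1 + a * σ ^ 2 := htmin.trans_le ht₁
  have hσy : ‖σ • y‖ ≤ ‖y‖ := by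
    rw [norm_smul, Real.norm_of_nonneg hσ.1]
    exact mul_le_of_le_one_left (norm_nonneg _) hσ.2
  have he := energyDensity_nonneg u x
  have hG := gauss_pos (σ • y) ht x
  calc ‖cutoffError u (cutoff R) y a σ x‖
      ≤ gauss (σ • y) (1 + a * σ ^ 2) x * (3 / 2 * energyDensity u x *
          (C₁ / R * ((|a| + ‖y‖) * (1 + ‖x‖)))) := by
        refine (norm_cutoffError_le u _ y ht x).trans ?_
        gcongr
        exacts [hcut R hR x, norm_smul_add_le y x a hσ]
    _ = 3 / 2 * energyDensity u x * (C₁ / R) * (|a| + ‖y‖) *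
          ((1 + ‖x‖) * gauss (σ • y) (1 + a * σ ^ 2) x) := by ring
    _ ≤ 3 / 2 * energyDensity u x * (C₁ / R) * (|a| + ‖y‖) * (C₂ * gauss 0 T x) :=
        mul_le_mul_of_nonneg_left (hdom _ _ hσy ht₁ ht₂ x) (by positivity)
    _ = L / R * (energyDensity u x * gauss 0 T x) := by ring

/-- The Gaussian energy at the point `(σ y, 1 + a σ²)` of a parabolic path, cut off at
radius `R`. -/
def cutoffGaussEnergy (u : E → H) (R : ℝ) (y : E) (a σ : ℝ) : ℝ :=
  2⁻¹ * ∫ x, cutoff R x * energyDensity u x *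
    ((1 + a * σ ^ 2) * gauss (σ • y) (1 + a * σ ^ 2) x)

lemma HasFiniteGaussEnergies.tendsto_cutoffGaussEnergy {u : E → H}
    (hfin : HasFiniteGaussEnergies u) (y : E) {a σ : ℝ} (ht : 0 < 1 + a * σ ^ 2) :
    Tendsto (fun k : ℕ => cutoffGaussEnergy u k y a σ) atTop
      (𝓝 (gaussEnergy (energyDensity u) (σ • y) (1 + a * σ ^ 2))) := by
  have h := (tendsto_integral_cutoff_pow_mul 1 (hfin (σ • y) ht)).const_mul ((1 + a * σ ^ 2) / 2)
  refine h.congr fun k => ?_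
  rw [cutoffGaussEnergy, ← integral_const_mul, ← integral_const_mul]
  refine integral_congr_ae (Eventually.of_forall fun x => ?_)
  simp only
  ring

lemma SatisfiesSolitonEquation.hasDerivAt_cutoffGaussEnergy {u : E → H}
    (hsol : SatisfiesSolitonEquation u) (hu : ContDiff ℝ 2 u) {R : ℝ} (hR : 0 < R) (y : E)
    {a σ : ℝ} (ht : 0 < 1 + a * σ ^ 2) :
    HasDerivAt (cutoffGaussEnergy u R y a) ((∫ x, cutoffError u (cutoff R) y a σ x) -
      σ / (2 * (1 + a * σ ^ 2)) * ∫ x, cutoff R x * pathDissipation u y a σ x) σ := by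
  have he : Continuous (energyDensity u) :=
    (contDiff_energyDensity (l := 0) (hu.of_le (m := 1) (by norm_num))).continuous
  rw [← hsol.integral_cutoff_path hu (contDiff_cutoff (k := 1) R) (hasCompactSupport_cutoff hR) y
    ht]
  refine (hasDerivAt_integral_mul_of_hasCompactSupport ((contDiff_cutoff (k := 0) R).continuous.mul
    he) (hasCompactSupport_cutoff hR).mul_right (U := {s | 0 < 1 + a * s ^ 2})
    (isOpen_lt continuous_const (by fun_prop)) (fun s _ => by fun_prop) ?_
    (fun s hs x => hasDerivAt_mul_gauss_path y x a s hs) ht).const_mul 2⁻¹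
  rintro ⟨s, x⟩ ⟨hs : 0 < 1 + a * s ^ 2, -⟩
  have hG : ContinuousAt (fun p : ℝ × E => gauss (p.1 • y) (1 + a * p.1 ^ 2) p.2) (s, x) :=
    continuousAt_gauss (by fun_prop) (by fun_prop) (by fun_prop) hs
  refine ContinuousAt.continuousWithinAt (hG.mul (ContinuousAt.add (by fun_prop) ?_))
  exact ContinuousAt.div (by fun_prop) (by fun_prop) (by positivity)

lemma setIntegral_pathDissipation_le {u : E → H} (hu : ContDiff ℝ 1 u) (y : E) {a σ : ℝ}
    (ht : 0 < 1 + a * σ ^ 2) {R : ℝ} (hR : 0 < R) {K : Set E} (hK : IsCompact K)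
    (hKR : ∀ x ∈ K, ‖x‖ ≤ R) :
    ∫ x in K, pathDissipation u y a σ x ≤ ∫ x, cutoff R x * pathDissipation u y a σ x := by
  have hcont := continuous_pathDissipation hu y a σ
  rw [← integral_indicator hK.measurableSet]
  refine integral_mono_ae ?_ ?_ (Eventually.of_forall fun x => ?_)
  · exact (integrable_indicator_iff hK.measurableSet).2 (hcont.continuousOn.integrableOn_compact hK)
  · exact integrable_of_eq_zero_off_tsupport (hasCompactSupport_cutoff hR)
      ((contDiff_cutoff (k := 0) R).continuous.mul hcont) fun x hx => by
        rw [image_eq_zero_of_notMem_tsupport hx, zero_mul]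
  · by_cases hx : x ∈ K
    · simp [indicator_of_mem hx, cutoff_eq_one hR (hKR x hx)]
    · simpa [indicator_of_notMem hx] using
        mul_nonneg (cutoff_nonneg R x) (pathDissipation_nonneg u y ht x)

lemma SatisfiesSolitonEquation.antitoneOn_cutoffGaussEnergy_add {u : E → H}
    (hsol : SatisfiesSolitonEquation u) (hu : ContDiff ℝ 2 u) (y : E) {a : ℝ} (ha : -1 < a)
    {K : Set E} (hK : IsCompact K) {R : ℝ} (hR : 0 < R) (hKR : ∀ x ∈ K, ‖x‖ ≤ R) {C : ℝ}
    (hC : ∀ σ ∈ Icc (0 : ℝ) 1, ∫ x, cutoffError u (cutoff R) y a σ x ≤ C)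
    {p p' : ℝ → ℝ} (hp : ∀ σ, HasDerivAt p (p' σ) σ)
    (hp' : ∀ σ ∈ Icc (0 : ℝ) 1,
      p' σ ≤ σ / (2 * (1 + a * σ ^ 2)) * ∫ x in K, pathDissipation u y a σ x) :
    AntitoneOn (fun σ => cutoffGaussEnergy u R y a σ + p σ - C * σ) (Icc 0 1) := by
  have hder : ∀ σ ∈ Icc (0 : ℝ) 1, ∃ d ≤ 0,
      HasDerivAt (fun σ => cutoffGaussEnergy u R y a σ + p σ - C * σ) d σ := by
    intro σ hσ
    have ht := path_time_pos ha hσ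
    refine ⟨_, ?_, ((hsol.hasDerivAt_cutoffGaussEnergy hu hR y ht).add (hp σ)).sub
      ((hasDerivAt_id σ).const_mul C)⟩
    have hdis := mul_le_mul_of_nonneg_left
      (setIntegral_pathDissipation_le (hu.of_le (by norm_num)) y ht hR hK hKR)
      (div_nonneg hσ.1 (by positivity : 0 ≤ 2 * (1 + a * σ ^ 2)))
    linarith [hC σ hσ, hp' σ hσ]
  choose! d hd_nonpos hd using hder
  exact antitoneOn_of_hasDerivWithinAt_nonpos (f' := d) (convex_Icc 0 1)
    (fun σ hσ => (hd σ hσ).continuousAt.continuousWithinAt)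
    (fun σ hσ => (hd σ (interior_subset hσ)).hasDerivWithinAt)
    (fun σ hσ => hd_nonpos σ (interior_subset hσ))

lemma SatisfiesSolitonEquation.gaussEnergy_path_add_antitoneOn {u : E → H}
    (hsol : SatisfiesSolitonEquation u) (hu : ContDiff ℝ 2 u) (hfin : HasFiniteGaussEnergies u)
    (y : E) {a : ℝ} (ha : -1 < a) {K : Set E} (hK : IsCompact K)
    {p p' : ℝ → ℝ} (hp : ∀ σ, HasDerivAt p (p' σ) σ)
    (hp' : ∀ σ ∈ Icc (0 : ℝ) 1,
      p' σ ≤ σ / (2 * (1 + a * σ ^ 2)) * ∫ x in K, pathDissipation u y a σ x) :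
    AntitoneOn (fun σ => gaussEnergy (energyDensity u) (σ • y) (1 + a * σ ^ 2) + p σ)
      (Icc 0 1) := by
  obtain ⟨C, hC⟩ := hfin.exists_integral_cutoffError_le y ha
  obtain ⟨ρ, hρ⟩ := hK.isBounded.exists_norm_le
  have hlim : ∀ σ ∈ Icc (0 : ℝ) 1,
      Tendsto (fun k : ℕ => cutoffGaussEnergy u k y a σ + p σ - C / k * σ) atTop
        (𝓝 (gaussEnergy (energyDensity u) (σ • y) (1 + a * σ ^ 2) + p σ)) := fun σ hσ => by
    simpa using ((hfin.tendsto_cutoffGaussEnergy y (path_time_pos ha hσ)).add_const (p σ)).sub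
      ((tendsto_const_div_atTop_nhds_zero_nat C).mul_const σ)
  intro σ₀ h₀ σ₁ h₁ h₀₁
  refine le_of_tendsto_of_tendsto (hlim σ₁ h₁) (hlim σ₀ h₀) ?_
  filter_upwards [tendsto_natCast_atTop_atTop.eventually_ge_atTop ρ, eventually_gt_atTop 0]
    with k hk hk_pos
  have hk_pos' : (0 : ℝ) < k := Nat.cast_pos.2 hk_pos
  exact hsol.antitoneOn_cutoffGaussEnergy_add hu y ha hK hk_pos' (fun x hx => (hρ x hx).trans hk)
    (hC k hk_pos') hp hp' h₀ h₁ h₀₁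

lemma SatisfiesSolitonEquation.gaussEnergy_path_antitoneOn {u : E → H}
    (hsol : SatisfiesSolitonEquation u) (hu : ContDiff ℝ 2 u) (hfin : HasFiniteGaussEnergies u)
    (y : E) {a : ℝ} (ha : -1 < a) :
    AntitoneOn (fun σ => gaussEnergy (energyDensity u) (σ • y) (1 + a * σ ^ 2)) (Icc 0 1) := by
  simpa using hsol.gaussEnergy_path_add_antitoneOn hu hfin y ha isCompact_empty (p := 0) (p' := 0)
    (fun σ => hasDerivAt_const σ 0) (by simp)

lemma SatisfiesSolitonEquation.gaussEnergy_le {u : E → H}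
    (hsol : SatisfiesSolitonEquation u) (hu : ContDiff ℝ 2 u) (hfin : HasFiniteGaussEnergies u)
    (y : E) {t : ℝ} (ht : 0 < t) :
    gaussEnergy (energyDensity u) y t ≤ gaussEnergy (energyDensity u) 0 1 := by
  simpa using hsol.gaussEnergy_path_antitoneOn hu hfin y (a := t - 1) (by linarith)
    (left_mem_Icc.2 zero_le_one) (right_mem_Icc.2 zero_le_one) zero_le_one

end MonotonicityFormula

section Soliton

lemma inner_fderiv_eq_zero_of_norm_eq_one {E H : Type*} [NormedAddCommGroup E] [NormedSpace ℝ E]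
    [NormedAddCommGroup H] [InnerProductSpace ℝ H] {u : E → H} (hu : ∀ y, ‖u y‖ = 1) {x : E}
    (hd : DifferentiableAt ℝ u x) (v : E) : ⟪u x, fderiv ℝ u x v⟫_ℝ = 0 := by
  have hconst : (fun y => ⟪u y, u y⟫_ℝ) = fun _ => (1 : ℝ) := by
    ext y
    rw [real_inner_self_eq_norm_sq, hu, one_pow]
  have h := fderiv_inner_apply ℝ hd hd v
  rw [hconst, fderiv_const_apply, zero_apply, real_inner_comm (u x)] at h
  linarith

variable {m n : ℕ} {f : Euc m → Sph n}

lemma norm_ambient (f : Euc m → Sph n) (x : Euc m) : ‖ambient f x‖ = 1 := by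
  simp [ambient]

lemma inner_ambient_fderiv (hf : IsSmooth f) (x v : Euc m) :
    ⟪ambient f x, fderiv ℝ (ambient f) x v⟫_ℝ = 0 :=
  inner_fderiv_eq_zero_of_norm_eq_one (norm_ambient f)
    ((contDiff_ambient hf).differentiable (by simp) x) v

lemma IsSoliton.inner_laplacian (hf : IsSoliton f) (x : Euc m)
    {w : Euc (n + 1)} (hw : ⟪ambient f x, w⟫_ℝ = 0) :
    ⟪Laplacian.laplacian (ambient f) x, w⟫_ℝ =
      ⟪fderiv ℝ (ambient f) x ((1 / 2 : ℝ) • x), w⟫_ℝ := by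
  have hmem : w ∈ (ℝ ∙ ambient f x)ᗮ := Submodule.mem_orthogonal_singleton_iff_inner_right.2 hw
  rw [← hf.2 x, tension, Submodule.inner_starProjection_left_eq_right,
    Submodule.starProjection_eq_self_iff.2 hmem]

lemma IsSoliton.satisfiesSolitonEquation (hf : IsSoliton f) :
    SatisfiesSolitonEquation (ambient f) :=
  fun x v => hf.inner_laplacian x (inner_ambient_fderiv hf.1 x v)

lemma hasFiniteGaussEnergies_ambient (hf : IsSmooth f) (hfin : entropy f ≠ ⊤) :
    HasFiniteGaussEnergies (ambient f) :=
  fun x₀ _ ht => integrable_energyDensity_mul_gauss hf hfin x₀ ht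

lemma IsSoliton.entropy_eq (hf : IsSoliton f) (hfin : entropy f ≠ ⊤) :
    entropy f = ENNReal.ofReal (gaussEnergy (energyDensity (ambient f)) 0 1) := by
  have hfin' := hasFiniteGaussEnergies_ambient hf.1 hfin
  refine le_antisymm (iSup₂_le fun x₀ t => iSup_le fun ht => ?_) ?_
  · rw [functionalF_eq_ofReal ht (hfin' x₀ ht)]
    exact ENNReal.ofReal_le_ofReal (hf.satisfiesSolitonEquation.gaussEnergy_le
      ((contDiff_ambient hf.1).of_le ENat.LEInfty.out) hfin' x₀ ht)
  · rw [← functionalF_eq_ofReal one_pos (hfin' 0 one_pos)]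
    exact functionalF_le_entropy f 0 one_pos

end Soliton

section Decay

variable {E H : Type*} [NormedAddCommGroup E] [InnerProductSpace ℝ E]
  [NormedAddCommGroup H] [InnerProductSpace ℝ H]

/-- The integral `∫₀¹ σ ‖Du x (a σ x + y)‖² dσ`, which controls the decay of the Gaussian energy
along the parabolic path from `(0, 1)` to `(y, 1 + a)`. -/
def decayDensity (u : E → H) (y : E) (a : ℝ) (x : E) : ℝ :=
  a ^ 2 / 4 * ‖fderiv ℝ u x x‖ ^ 2 + 2 * a / 3 * ⟪fderiv ℝ u x x, fderiv ℝ u x y⟫_ℝ +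
    2⁻¹ * ‖fderiv ℝ u x y‖ ^ 2

lemma continuous_decayDensity {u : E → H} (hu : ContDiff ℝ 1 u) (y : E) (a : ℝ) :
    Continuous (decayDensity u y a) := by
  have := hu.continuous_fderiv (by simp)
  unfold decayDensity
  fun_prop

lemma decayDensity_ge (u : E → H) (y : E) (a : ℝ) (x : E) :
    72⁻¹ * (a ^ 2 * ‖fderiv ℝ u x x‖ ^ 2) + 72⁻¹ * ‖fderiv ℝ u x y‖ ^ 2 ≤
      decayDensity u y a x := by
  have h := sq_nonneg ‖(24 / 35 * a) • fderiv ℝ u x x + fderiv ℝ u x y‖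
  rw [norm_add_sq_real, norm_smul, real_inner_smul_left, mul_pow, Real.norm_eq_abs, sq_abs] at h
  unfold decayDensity
  nlinarith [sq_nonneg (a * ‖fderiv ℝ u x x‖), sq_nonneg ‖fderiv ℝ u x y‖]

lemma decayDensity_nonneg (u : E → H) (y : E) (a : ℝ) (x : E) : 0 ≤ decayDensity u y a x :=
  le_trans (by positivity) (decayDensity_ge u y a x)

lemma eventually_gauss_comparison {K : Set E} (hK : IsCompact K) {κ : ℝ} (hκ : κ < 1) :
    ∀ᶠ p : E × ℝ in 𝓝 (0, 0), ∀ σ ∈ Icc (0 : ℝ) 1, ∀ x ∈ K,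
      κ * gauss p.1 (1 + p.2) x * (1 + p.2 * σ ^ 2) ≤ gauss (σ • p.1) (1 + p.2 * σ ^ 2) x := by
  have htube : ∀ᶠ p : E × ℝ in 𝓝 (0, 0), ∀ q ∈ Icc (0 : ℝ) 1 ×ˢ K,
      κ * gauss p.1 (1 + p.2) q.2 * (1 + p.2 * q.1 ^ 2) <
        gauss (q.1 • p.1) (1 + p.2 * q.1 ^ 2) q.2 := by
    refine (isCompact_Icc.prod hK).eventually_forall_of_forall_eventually fun q _ => ?_
    refine ContinuousAt.eventually_lt
      (f := fun z : (E × ℝ) × ℝ × E =>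
        κ * gauss z.1.1 (1 + z.1.2) z.2.2 * (1 + z.1.2 * z.2.1 ^ 2))
      (g := fun z => gauss (z.2.1 • z.1.1) (1 + z.1.2 * z.2.1 ^ 2) z.2.2)
      (((continuousAt_gauss ?_ ?_ ?_ ?_).const_mul κ).mul ?_) (continuousAt_gauss ?_ ?_ ?_ ?_) ?_
    case refine_10 => simpa using mul_lt_of_lt_one_left (gauss_pos (0 : E) one_pos q.2) hκ
    all_goals first | fun_prop | simp
  exact htube.mono fun p hp σ hσ x hx => (hp (σ, x) ⟨hσ, hx⟩).le

variable [MeasurableSpace E] [BorelSpace E]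

lemma hasDerivAt_setIntegral_decayDensity {μ : Measure E} [IsFiniteMeasureOnCompacts μ] {u : E → H}
    (hu : ContDiff ℝ 1 u) {g : E → ℝ} (hg : Continuous g) {K : Set E} (hK : IsCompact K)
    (y : E) (a σ : ℝ) :
    HasDerivAt (fun σ => ∫ x in K, decayDensity u (σ • y) (a * σ ^ 2) x * g x ∂μ)
      (σ * ∫ x in K, ‖fderiv ℝ u x ((a * σ) • x + y)‖ ^ 2 * g x ∂μ) σ := by
  have := hu.continuous_fderiv (by simp)
  let A := ∫ x in K, ‖fderiv ℝ u x x‖ ^ 2 * g x ∂μ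
  let B := ∫ x in K, ⟪fderiv ℝ u x x, fderiv ℝ u x y⟫_ℝ * g x ∂μ
  let D := ∫ x in K, ‖fderiv ℝ u x y‖ ^ 2 * g x ∂μ
  have hcomb : ∀ α β δ : ℝ, ∫ x in K, (α * (‖fderiv ℝ u x x‖ ^ 2 * g x) +
      β * (⟪fderiv ℝ u x x, fderiv ℝ u x y⟫_ℝ * g x) + δ * (‖fderiv ℝ u x y‖ ^ 2 * g x)) ∂μ =
      α * A + β * B + δ * D := fun α β δ => by
    have hint : ∀ {h : E → ℝ}, Continuous h → Integrable h (μ.restrict K) := fun hh =>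
      hh.continuousOn.integrableOn_compact hK
    rw [integral_add (hint (by fun_prop)) (hint (by fun_prop)),
      integral_add (hint (by fun_prop)) (hint (by fun_prop)), integral_const_mul,
      integral_const_mul, integral_const_mul]
  have hdecay : (fun σ => ∫ x in K, decayDensity u (σ • y) (a * σ ^ 2) x * g x ∂μ) =
      fun σ => a ^ 2 / 4 * A * σ ^ 4 + 2 * a / 3 * B * σ ^ 3 + 2⁻¹ * D * σ ^ 2 := by
    ext σ
    rw [show a ^ 2 / 4 * A * σ ^ 4 + 2 * a / 3 * B * σ ^ 3 + 2⁻¹ * D * σ ^ 2 =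
      a ^ 2 / 4 * σ ^ 4 * A + 2 * a / 3 * σ ^ 3 * B + 2⁻¹ * σ ^ 2 * D by ring, ← hcomb]
    congr 1 with x
    simp only [decayDensity, map_smul, inner_smul_right, norm_smul, mul_pow, Real.norm_eq_abs,
      sq_abs]
    ring
  have hpath : ∫ x in K, ‖fderiv ℝ u x ((a * σ) • x + y)‖ ^ 2 * g x ∂μ =
      (a * σ) ^ 2 * A + 2 * (a * σ) * B + 1 * D := by
    rw [← hcomb]
    congr 1 with x
    rw [map_add, map_smul, norm_add_sq_real, norm_smul, real_inner_smul_left, mul_pow,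
      Real.norm_eq_abs, sq_abs]
    ring
  rw [hdecay, hpath]
  refine ((((hasDerivAt_pow 4 σ).const_mul (a ^ 2 / 4 * A)).add
    ((hasDerivAt_pow 3 σ).const_mul (2 * a / 3 * B))).add
    ((hasDerivAt_pow 2 σ).const_mul (2⁻¹ * D))).congr_deriv ?_
  push_cast
  ring

variable [FiniteDimensional ℝ E]

lemma SatisfiesSolitonEquation.eventually_gaussEnergy_add_decay_le {u : E → H}
    (hsol : SatisfiesSolitonEquation u) (hu : ContDiff ℝ 2 u) (hfin : HasFiniteGaussEnergies u)
    {K : Set E} (hK : IsCompact K) {κ : ℝ} (hκ : κ < 1) :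
    ∀ᶠ p : E × ℝ in 𝓝 (0, 0), gaussEnergy (energyDensity u) p.1 (1 + p.2) +
      κ / 2 * ∫ x in K, decayDensity u p.1 p.2 x * gauss p.1 (1 + p.2) x ≤
        gaussEnergy (energyDensity u) 0 1 := by
  have hu₁ : ContDiff ℝ 1 u := hu.of_le (by norm_num)
  have := hu₁.continuous_fderiv (by simp)
  have htime : ∀ᶠ p : E × ℝ in 𝓝 (0, 0), -1 < p.2 :=
    continuousAt_snd.eventually_const_lt (by norm_num)
  filter_upwards [eventually_gauss_comparison hK hκ, htime] with ⟨y, a⟩ hcomp ha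
  have hmono := hsol.gaussEnergy_path_add_antitoneOn hu hfin y ha hK
    (fun σ => (hasDerivAt_setIntegral_decayDensity (μ := volume) hu₁
      (continuous_gauss y (1 + a)) hK y a σ).const_mul (κ / 2)) fun σ hσ => ?_
  · simpa [decayDensity] using
      hmono (left_mem_Icc.2 zero_le_one) (right_mem_Icc.2 zero_le_one) zero_le_one
  have ht : 0 < 1 + a * σ ^ 2 := path_time_pos ha hσ
  have hint : ∀ {h : E → ℝ}, Continuous h → IntegrableOn h K := fun hh =>
    hh.continuousOn.integrableOn_compact hK
  calc κ / 2 * (σ * ∫ x in K, ‖fderiv ℝ u x ((a * σ) • x + y)‖ ^ 2 * gauss y (1 + a) x)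
      = σ / (2 * (1 + a * σ ^ 2)) * ∫ x in K, κ * gauss y (1 + a) x * (1 + a * σ ^ 2) *
          ‖fderiv ℝ u x ((a * σ) • x + y)‖ ^ 2 := by
        simp only [← integral_const_mul]
        congr 1 with x
        rw [eq_comm, div_mul_eq_mul_div, div_eq_iff (by positivity)]
        ring
    _ ≤ σ / (2 * (1 + a * σ ^ 2)) * ∫ x in K, pathDissipation u y a σ x := by
        refine mul_le_mul_of_nonneg_left (setIntegral_mono_on (hint (by fun_prop))
          (hint (continuous_pathDissipation hu₁ y a σ)) hK.measurableSet fun x hx => ?_)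
          (div_nonneg hσ.1 (by positivity))
        exact mul_le_mul_of_nonneg_right (hcomp σ hσ x hx) (sq_nonneg _)

end Decay

section StrictMaximum

lemma fderiv_eq_zero_of_radial {E H : Type*} [NormedAddCommGroup E] [NormedSpace ℝ E]
    [NormedAddCommGroup H] [NormedSpace ℝ H] {u : E → H} (hu : Differentiable ℝ u)
    (h : ∀ x, fderiv ℝ u x x = 0) (x : E) : fderiv ℝ u x = 0 := by
  suffices hconst : ∀ x, u x = u 0 by
    rw [funext hconst, fderiv_const_apply]
  intro x
  have hder : ∀ t : ℝ, HasDerivAt (fun t : ℝ => u (t • x)) (fderiv ℝ u (t • x) x) t := fun t =>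
    (hu (t • x)).hasFDerivAt.comp_hasDerivAt t (by simpa using (hasDerivAt_id t).smul_const x)
  have hzero : ∀ t ∈ Ioi (0 : ℝ), deriv (fun t : ℝ => u (t • x)) t = 0 := fun t (ht : 0 < t) => by
    have hrad := h (t • x)
    rw [map_smul] at hrad
    rw [(hder t).deriv, (smul_eq_zero.1 hrad).resolve_left ht.ne']
  have hray : ∀ t ∈ Ioi (0 : ℝ), u x = u (t • x) := fun t ht => by
    simpa using isOpen_Ioi.is_const_of_deriv_eq_zero isPreconnected_Ioi
      (fun t _ => (hder t).differentiableAt.differentiableWithinAt) hzero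
      (mem_Ioi.2 one_pos) ht
  have hlim : Tendsto (fun t : ℝ => u (t • x)) (𝓝[>] 0) (𝓝 (u 0)) := by
    simpa using ((hder 0).continuousAt.tendsto).mono_left nhdsWithin_le_nhds
  exact tendsto_nhds_unique (tendsto_const_nhds.congr' (eventually_mem_nhdsWithin.mono hray)) hlim

lemma eq_zero_of_setIntegral_nonpos {X : Type*} [TopologicalSpace X] [T2Space X]
    [MeasurableSpace X] [OpensMeasurableSpace X] {μ : Measure X} [IsFiniteMeasureOnCompacts μ]
    [μ.IsOpenPosMeasure] {h : X → ℝ} (hcont : Continuous h) (hnonneg : ∀ x, 0 ≤ h x) {K : Set X}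
    (hK : IsCompact K) (hint : ∫ x in K, h x ∂μ ≤ 0) {x : X} (hx : x ∈ interior K) : h x = 0 := by
  have hzero := hint.antisymm (integral_nonneg hnonneg)
  rw [setIntegral_eq_zero_iff_of_nonneg_ae (Eventually.of_forall hnonneg)
    (hcont.continuousOn.integrableOn_compact hK)] at hzero
  exact Measure.eqOn_open_of_ae_eq (ae_restrict_of_ae_restrict_of_subset interior_subset hzero)
    isOpen_interior hcont.continuousOn continuousOn_const hx

/-- The parabolic size of a point `(y, a)` of space-time: parabolic rescaling by `s` multiplies it
by `s²`. -/
def parabolicSize {E : Type*} [Norm E] (p : E × ℝ) : ℝ := ‖p.1‖ ^ 2 + |p.2|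

lemma abs_snd_le_parabolicSize {E : Type*} [Norm E] (p : E × ℝ) : |p.2| ≤ parabolicSize p :=
  le_add_of_nonneg_left (sq_nonneg _)

lemma parabolicSize_smul {E : Type*} [SeminormedAddCommGroup E] [NormedSpace ℝ E] (y : E)
    (a s : ℝ) : parabolicSize (s • y, a * s ^ 2) = s ^ 2 * parabolicSize (y, a) := by
  simp only [parabolicSize, norm_smul, mul_pow, Real.norm_eq_abs, sq_abs, abs_mul,
    abs_of_nonneg (sq_nonneg s)]
  ring

lemma exists_parabolicSize_le_subset {E : Type*} [SeminormedAddCommGroup E] {U : Set (E × ℝ)}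
    (hU : U ∈ 𝓝 (0, 0)) : ∃ r : ℝ, 0 < r ∧ r < 1 ∧ {p | parabolicSize p ≤ r} ⊆ U := by
  obtain ⟨ε, hε, hball⟩ := Metric.mem_nhds_iff.1 hU
  let δ := min ε 1 / 2
  have hδ : 0 < δ := by positivity
  have hδε : 2 * δ ≤ ε := by linarith [min_le_left ε 1, show 2 * δ = min ε 1 by ring]
  have hδ_one : 2 * δ ≤ 1 := by linarith [min_le_right ε 1, show 2 * δ = min ε 1 by ring]
  refine ⟨δ ^ 2, by positivity, by nlinarith, ?_⟩
  intro p (hp : ‖p.1‖ ^ 2 + |p.2| ≤ δ ^ 2)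
  have hspace : ‖p.1‖ ≤ δ := abs_le_of_sq_le_sq' (by linarith [abs_nonneg p.2]) hδ.le |>.2
  have htime : |p.2| ≤ δ := by nlinarith [sq_nonneg ‖p.1‖]
  refine hball ?_
  rw [Metric.mem_ball, Prod.dist_eq, dist_zero_right, dist_zero_right, Real.norm_eq_abs]
  exact max_lt (by linarith) (by linarith)

variable {E H : Type*} [NormedAddCommGroup E] [InnerProductSpace ℝ E] [FiniteDimensional ℝ E]
  [NormedAddCommGroup H] [InnerProductSpace ℝ H]

lemma isCompact_parabolicSize_eq (r : ℝ) : IsCompact {p : E × ℝ | parabolicSize p = r} := by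
  have : Continuous fun p : E × ℝ => parabolicSize p := by unfold parabolicSize; fun_prop
  refine Metric.isCompact_of_isClosed_isBounded (isClosed_eq this continuous_const)
    ((Metric.isBounded_closedBall (x := ((0 : E), (0 : ℝ))) (r := max r 1)).subset ?_)
  rintro p (rfl : _ = r)
  rw [Metric.mem_closedBall, Prod.dist_eq, dist_zero_right, dist_zero_right, Real.norm_eq_abs]
  refine max_le ?_ (le_max_of_le_left (abs_snd_le_parabolicSize p))
  rcases le_total ‖p.1‖ 1 with h | h
  · exact le_max_of_le_right h
  · exact le_max_of_le_left ((le_self_pow₀ h two_ne_zero).trans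
      (le_add_of_nonneg_right (abs_nonneg _)))

variable [MeasurableSpace E] [BorelSpace E]

lemma SatisfiesSolitonEquation.decayDensity_path_eq_zero {u : E → H}
    (hsol : SatisfiesSolitonEquation u) (hu : ContDiff ℝ 2 u) (hfin : HasFiniteGaussEnergies u)
    {y : E} {a : ℝ} (ha : -1 < a)
    (hmax : gaussEnergy (energyDensity u) 0 1 ≤ gaussEnergy (energyDensity u) y (1 + a)) (x : E) :
    ∃ s : ℝ, 0 < s ∧ decayDensity u (s • y) (a * s ^ 2) x = 0 := by
  have hu₁ : ContDiff ℝ 1 u := hu.of_le (by norm_num)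
  have hpath : Tendsto (fun s : ℝ => (s • y, a * s ^ 2)) (𝓝[>] 0) (𝓝 (0, 0)) := by
    have : Continuous fun s : ℝ => (s • y, a * s ^ 2) := by fun_prop
    simpa using (this.tendsto 0).mono_left nhdsWithin_le_nhds
  obtain ⟨s, hdecay, hs⟩ := ((hpath.eventually (hsol.eventually_gaussEnergy_add_decay_le hu hfin
    (isCompact_closedBall 0 (‖x‖ + 1)) (κ := 1 / 2) (by norm_num))).and
    (Ioo_mem_nhdsGT one_pos)).exists
  have ht := path_time_pos ha (Ioo_subset_Icc_self hs)
  have hmono := hsol.gaussEnergy_path_antitoneOn hu hfin y ha (Ioo_subset_Icc_self hs)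
    (right_mem_Icc.2 zero_le_one) hs.2.le
  simp only [one_smul, one_pow, mul_one] at hmono
  have hzero := eq_zero_of_setIntegral_nonpos (μ := volume) (x := x)
    ((continuous_decayDensity hu₁ (s • y) (a * s ^ 2)).mul
      (continuous_gauss (s • y) (1 + a * s ^ 2)))
    (fun x => mul_nonneg (decayDensity_nonneg u _ _ x) (gauss_pos _ ht x).le)
    (isCompact_closedBall 0 (‖x‖ + 1)) (by simp only [Pi.mul_apply]; linarith)
    (Metric.ball_subset_interior_closedBall (by simp))
  exact ⟨s, hs.1, (mul_eq_zero.1 hzero).resolve_right (gauss_pos _ ht x).ne'⟩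

lemma SatisfiesSolitonEquation.fderiv_eq_zero_of_isMax {u : E → H}
    (hsol : SatisfiesSolitonEquation u) (hu : ContDiff ℝ 2 u) (hfin : HasFiniteGaussEnergies u)
    {y : E} {a : ℝ} (ha : -1 < a)
    (hmax : gaussEnergy (energyDensity u) 0 1 ≤ gaussEnergy (energyDensity u) y (1 + a)) (x : E) :
    a • fderiv ℝ u x x = 0 ∧ fderiv ℝ u x y = 0 := by
  obtain ⟨s, hs, hzero⟩ := hsol.decayDensity_path_eq_zero hu hfin ha hmax x
  have hle := decayDensity_ge u (s • y) (a * s ^ 2) x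
  have hsum : s ^ 4 * ‖a • fderiv ℝ u x x‖ ^ 2 + s ^ 2 * ‖fderiv ℝ u x y‖ ^ 2 ≤ 0 := by
    rw [hzero, map_smul, norm_smul, mul_pow ‖s‖, Real.norm_eq_abs, sq_abs] at hle
    rw [norm_smul, Real.norm_eq_abs, mul_pow, sq_abs]
    linarith
  constructor
  · have h : s ^ 4 * ‖a • fderiv ℝ u x x‖ ^ 2 = 0 := le_antisymm
      (by linarith [show 0 ≤ s ^ 2 * ‖fderiv ℝ u x y‖ ^ 2 by positivity]) (by positivity)
    simpa [hs.ne'] using h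
  · have h : s ^ 2 * ‖fderiv ℝ u x y‖ ^ 2 = 0 := le_antisymm
      (by linarith [show 0 ≤ s ^ 4 * ‖a • fderiv ℝ u x x‖ ^ 2 by positivity]) (by positivity)
    simpa [hs.ne'] using h

lemma SatisfiesSolitonEquation.gaussEnergy_lt [Nontrivial E] {u : E → H}
    (hsol : SatisfiesSolitonEquation u) (hu : ContDiff ℝ 2 u) (hfin : HasFiniteGaussEnergies u)
    (hcyl : ∀ ζ, (∀ x, fderiv ℝ u x ζ = 0) → ζ = 0) {y : E} {a : ℝ} (ha : -1 < a)
    (hya : (y, a) ≠ 0) :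
    gaussEnergy (energyDensity u) y (1 + a) < gaussEnergy (energyDensity u) 0 1 := by
  by_contra! hmax
  have hzero := hsol.fderiv_eq_zero_of_isMax hu hfin ha hmax
  have hy : y = 0 := hcyl y fun x => (hzero x).2
  have ha_ne : a ≠ 0 := fun ha_zero => hya (by rw [hy, ha_zero, Prod.mk_zero_zero])
  have hconst := fderiv_eq_zero_of_radial (hu.differentiable (by simp)) fun x =>
    (smul_eq_zero.1 (hzero x).1).resolve_left ha_ne
  obtain ⟨ζ, hζ⟩ := exists_ne (0 : E)
  exact hζ (hcyl ζ fun x => by rw [hconst, zero_apply])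

lemma continuousAt_integral_mul_gauss {h : E → ℝ} (hmeas : AEStronglyMeasurable h)
    (hint : ∀ {t : ℝ}, 0 < t → Integrable fun x => h x * gauss 0 t x) {p : E × ℝ} (hp : 0 < p.2) :
    ContinuousAt (fun p : E × ℝ => ∫ x, h x * gauss p.1 p.2 x) p := by
  obtain ⟨C, -, hdom⟩ := exists_gauss_dominated E (t₁ := p.2 / 2) (t₂ := 2 * p.2)
    (by positivity) (by positivity) (‖p.1‖ + 1)
  refine continuousAt_of_dominated
    (bound := fun x => C * ‖h x * gauss 0 (2 * (2 * p.2)) x‖) ?_ ?_ ?_ ?_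
  · exact Eventually.of_forall fun q => hmeas.mul (continuous_gauss _ _).aestronglyMeasurable
  · have hspace : ∀ᶠ q : E × ℝ in 𝓝 p, ‖q.1‖ < ‖p.1‖ + 1 :=
      ContinuousAt.eventually_lt (by fun_prop) continuousAt_const (by linarith)
    have htime : ∀ᶠ q : E × ℝ in 𝓝 p, q.2 ∈ Ioo (p.2 / 2) (2 * p.2) :=
      continuousAt_snd.eventually_mem (Ioo_mem_nhds (by linarith) (by linarith))
    filter_upwards [hspace, htime] with q hq₁ hq₂
    refine Eventually.of_forall fun x => ?_
    have hG := gauss_pos q.1 (show 0 < q.2 by linarith [hq₂.1]) x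
    have hG₀ := gauss_pos (0 : E) (show 0 < 2 * (2 * p.2) by positivity) x
    rw [norm_mul, norm_mul, Real.norm_of_nonneg hG.le, Real.norm_of_nonneg hG₀.le,
      mul_left_comm]
    refine mul_le_mul_of_nonneg_left (le_trans ?_ (hdom q.1 q.2 hq₁.le hq₂.1.le hq₂.2.le x))
      (norm_nonneg _)
    exact le_mul_of_one_le_left hG.le (by linarith [norm_nonneg x])
  · exact (hint (by positivity)).norm.const_mul C
  · exact Eventually.of_forall fun x => continuousAt_const.mul
      (continuousAt_gauss (by fun_prop) (by fun_prop) (by fun_prop) hp)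

lemma continuousAt_gaussEnergy {h : E → ℝ} (hmeas : AEStronglyMeasurable h)
    (hint : ∀ {t : ℝ}, 0 < t → Integrable fun x => h x * gauss 0 t x) {p : E × ℝ}
    (hp : 0 < 1 + p.2) :
    ContinuousAt (fun p : E × ℝ => gaussEnergy h p.1 (1 + p.2)) p := by
  unfold gaussEnergy
  refine ContinuousAt.mul (by fun_prop) ?_
  exact ContinuousAt.comp (g := fun p : E × ℝ => ∫ x, h x * gauss p.1 p.2 x)
    (f := fun p : E × ℝ => (p.1, 1 + p.2)) (continuousAt_integral_mul_gauss hmeas hint hp)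
    (by fun_prop)

/-- By compactness, it is enough to bound the energy on a parabolic sphere around `(0, 1)`: the
energy decreases along the parabolic paths crossing that sphere. -/
lemma SatisfiesSolitonEquation.exists_gaussEnergy_le_of_notMem_nhds [Nontrivial E] {u : E → H}
    (hsol : SatisfiesSolitonEquation u) (hu : ContDiff ℝ 2 u) (hfin : HasFiniteGaussEnergies u)
    (hcyl : ∀ ζ, (∀ x, fderiv ℝ u x ζ = 0) → ζ = 0) {U : Set (E × ℝ)} (hU : U ∈ 𝓝 (0, 0)) :
    ∃ M < gaussEnergy (energyDensity u) 0 1, ∀ p ∉ U, -1 < p.2 →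
      gaussEnergy (energyDensity u) p.1 (1 + p.2) ≤ M := by
  have he := (contDiff_energyDensity (l := 0) (hu.of_le one_le_two)).continuous
  obtain ⟨r, hr, hr_one, hrU⟩ := exists_parabolicSize_le_subset hU
  have htime : ∀ p : E × ℝ, parabolicSize p = r → -1 < p.2 := fun p hp => by
    linarith [neg_abs_le p.2, abs_snd_le_parabolicSize p]
  have hne : {p : E × ℝ | parabolicSize p = r}.Nonempty :=
    ⟨(0, r), by simp [parabolicSize, abs_of_pos hr]⟩
  obtain ⟨q, hq, hqmax⟩ := (isCompact_parabolicSize_eq r).exists_isMaxOn hne fun p hp =>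
    (continuousAt_gaussEnergy he.aestronglyMeasurable (hfin 0)
      (by linarith [htime p hp])).continuousWithinAt
  refine ⟨_, hsol.gaussEnergy_lt hu hfin hcyl (y := q.1) (htime q hq) ?_, ?_⟩
  · rintro hq_zero
    rw [mem_ofPred_eq, show q = 0 from hq_zero] at hq
    exact hr.ne' (by simpa [parabolicSize] using hq.symm)
  · rintro ⟨y, a⟩ hp ha
    have hlt : r < parabolicSize (y, a) := not_le.1 fun h => hp (hrU h)
    have hpos : 0 < parabolicSize (y, a) := hr.trans hlt
    let s := √(r / parabolicSize (y, a))
    have hs : s ∈ Icc (0 : ℝ) 1 :=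
      ⟨Real.sqrt_nonneg _, Real.sqrt_le_one.2 ((div_le_one hpos).2 hlt.le)⟩
    have hmem : parabolicSize (s • y, a * s ^ 2) = r := by
      rw [parabolicSize_smul, Real.sq_sqrt (by positivity), div_mul_cancel₀ _ hpos.ne']
    have hmono := hsol.gaussEnergy_path_antitoneOn hu hfin y ha hs (right_mem_Icc.2 zero_le_one)
      hs.2
    simp only [one_smul, one_pow, mul_one] at hmono
    exact hmono.trans (hqmax hmem)

end StrictMaximum

section UnitNorm

variable {E H : Type*} [NormedAddCommGroup E] [NormedSpace ℝ E]
  [NormedAddCommGroup H] [InnerProductSpace ℝ H]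

lemma norm_add_smul_sq {u w : H} (hu : ‖u‖ = 1) (h : ⟪u, w⟫_ℝ = 0) (s : ℝ) :
    ‖u + s • w‖ ^ 2 = 1 + s ^ 2 * ‖w‖ ^ 2 := by
  rw [norm_add_sq_real, hu, inner_smul_right, h, norm_smul, mul_pow, Real.norm_eq_abs, sq_abs]
  ring

/-- For a unit vector field `v = r U`, the derivative of `r` contributes to that of `v` a multiple
of `v`, which is orthogonal to the derivative of `v`. -/
lemma norm_fderiv_smul_le_of_norm_eq_one {r : E → ℝ} {U : E → H} {x : E}
    (hr : DifferentiableAt ℝ r x) (hU : DifferentiableAt ℝ U x) (hpos : 0 < r x)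
    (hv : ∀ y, ‖r y • U y‖ = 1) (h : E) :
    ‖fderiv ℝ (fun y => r y • U y) x h‖ ≤ r x * ‖fderiv ℝ U x h‖ := by
  set d := fderiv ℝ (fun y => r y • U y) x h with hd
  have hperp : ⟪U x, d⟫_ℝ = 0 := by
    have hzero := inner_fderiv_eq_zero_of_norm_eq_one hv (hr.smul hU) h
    rw [real_inner_smul_left] at hzero
    exact (mul_eq_zero.1 hzero).resolve_left hpos.ne'
  have hdecomp : d = r x • fderiv ℝ U x h + fderiv ℝ r x h • U x := by
    rw [hd, fderiv_fun_smul hr hU]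
    simp
  have hsq : ‖d‖ ^ 2 = r x * ⟪fderiv ℝ U x h, d⟫_ℝ := by
    rw [← real_inner_self_eq_norm_sq]
    nth_rewrite 1 [hdecomp]
    rw [inner_add_left, real_inner_smul_left, real_inner_smul_left, hperp, mul_zero, add_zero]
  have hle : ‖d‖ * ‖d‖ ≤ r x * ‖fderiv ℝ U x h‖ * ‖d‖ := by
    rw [← sq, hsq, mul_assoc]
    exact mul_le_mul_of_nonneg_left (real_inner_le_norm _ _) hpos.le
  rcases (norm_nonneg d).eq_or_lt with h0 | h0
  · rw [← h0]
    positivity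
  · exact le_of_mul_le_mul_right hle h0

end UnitNorm

section RemainderEstimate

variable {E H : Type*} [NormedAddCommGroup E] [InnerProductSpace ℝ E] [FiniteDimensional ℝ E]
  [NormedAddCommGroup H] [InnerProductSpace ℝ H]

lemma energyDensity_smul_le_of_norm_eq_one {r : E → ℝ} {U : E → H} {x : E}
    (hr : DifferentiableAt ℝ r x) (hU : DifferentiableAt ℝ U x) (hpos : 0 < r x)
    (hv : ∀ y, ‖r y • U y‖ = 1) :
    energyDensity (fun y => r y • U y) x ≤ r x ^ 2 * energyDensity U x := by
  simp only [energyDensity_eq_sum_norm_sq (stdOrthonormalBasis ℝ E), Finset.mul_sum, ← mul_pow]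
  gcongr
  exact norm_fderiv_smul_le_of_norm_eq_one hr hU hpos hv _

lemma energyDensity_add_smul {u w : E → H} {x : E} (hu : DifferentiableAt ℝ u x)
    (hw : DifferentiableAt ℝ w x) (s : ℝ) :
    energyDensity (fun y => u y + s • w y) x =
      energyDensity u x + 2 * s * gradInner u w x + s ^ 2 * energyDensity w x := by
  simp only [energyDensity_eq_sum_norm_sq (stdOrthonormalBasis ℝ E), gradInner, Finset.mul_sum,
    ← Finset.sum_add_distrib]
  refine Finset.sum_congr rfl fun i _ => ?_
  rw [fderiv_fun_add hu (hw.fun_const_smul s), fderiv_fun_const_smul hw, add_apply, smul_apply,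
    norm_add_sq_real, inner_smul_right, norm_smul, mul_pow, Real.norm_eq_abs, sq_abs]
  ring

lemma inv_one_add_mul_le {s e p q θ : ℝ} (hs : |s| ≤ 1) (hq : 0 ≤ q) (hθ : 0 ≤ θ)
    (hpos : 0 ≤ e + 2 * s * p + s ^ 2 * q) :
    (1 + s ^ 2 * θ)⁻¹ * (e + 2 * s * p + s ^ 2 * q) ≤ e + 2 * s * p + s ^ 2 * (q - e * θ) +
      |s| ^ 3 * (θ * (2 * |p| + q) + θ ^ 2 * (e + 2 * |p| + q)) := by
  have hs0 := abs_nonneg s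
  have hsp : |s * p| = |s| * |p| := abs_mul s p
  have hinv : (1 + s ^ 2 * θ)⁻¹ ≤ 1 - s ^ 2 * θ + (s ^ 2 * θ) ^ 2 := by
    rw [inv_le_iff_one_le_mul₀ (by positivity)]
    have : 0 ≤ (s ^ 2 * θ) ^ 3 := by positivity
    linarith
  have hcubic : -(s ^ 2 * θ * (2 * s * p + s ^ 2 * q)) ≤ |s| ^ 3 * (θ * (2 * |p| + q)) := by
    have hp : -(s * p) ≤ |s| * |p| := hsp ▸ neg_le_abs _
    calc -(s ^ 2 * θ * (2 * s * p + s ^ 2 * q))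
        = |s| ^ 2 * θ * (2 * -(s * p)) - s ^ 2 * θ * (s ^ 2 * q) := by rw [sq_abs]; ring
      _ ≤ |s| ^ 2 * θ * (2 * (|s| * |p|)) - 0 := by gcongr; positivity
      _ ≤ |s| ^ 3 * (θ * (2 * |p| + q)) := by
        have : 0 ≤ |s| ^ 3 * (θ * q) := by positivity
        linarith
  have hquartic : (s ^ 2 * θ) ^ 2 * (e + 2 * s * p + s ^ 2 * q) ≤
      |s| ^ 3 * (θ ^ 2 * (e + 2 * |p| + q)) := by
    have hp : s * p ≤ |p| :=
      (le_abs_self _).trans (hsp.trans_le (mul_le_of_le_one_left (abs_nonneg p) hs))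
    have hs2 : s ^ 2 ≤ 1 := (sq_le_one_iff_abs_le_one s).2 hs
    calc (s ^ 2 * θ) ^ 2 * (e + 2 * s * p + s ^ 2 * q)
        = |s| ^ 4 * (θ ^ 2 * (e + 2 * (s * p) + s ^ 2 * q)) := by
          rw [show |s| ^ 4 = (|s| ^ 2) ^ 2 by ring, sq_abs]; ring
      _ ≤ |s| ^ 3 * (θ ^ 2 * (e + 2 * |p| + 1 * q)) := by
          gcongr ?_ * (θ ^ 2 * (e + 2 * ?_ + ?_ * q))
          · exact mul_nonneg (sq_nonneg _) (by linarith)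
          · exact pow_le_pow_of_le_one hs0 hs (by norm_num)
      _ = |s| ^ 3 * (θ ^ 2 * (e + 2 * |p| + q)) := by rw [one_mul]
  calc (1 + s ^ 2 * θ)⁻¹ * (e + 2 * s * p + s ^ 2 * q)
      ≤ (1 - s ^ 2 * θ + (s ^ 2 * θ) ^ 2) * (e + 2 * s * p + s ^ 2 * q) := by gcongr
    _ = e + 2 * s * p + s ^ 2 * (q - e * θ) - s ^ 2 * θ * (2 * s * p + s ^ 2 * q) +
        (s ^ 2 * θ) ^ 2 * (e + 2 * s * p + s ^ 2 * q) := by ring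
    _ ≤ _ := by linarith

/-- The second order coefficient of the energy density along the variation `(u + s w) / |u + s w|`
of a map `u` with values in the unit sphere. -/
def secondVariationDensity (u w : E → H) (x : E) : ℝ :=
  energyDensity w x - energyDensity u x * ‖w x‖ ^ 2

/-- A bound for the third order remainder of the energy density along the variation
`(u + s w) / |u + s w|`. -/
def energyRemainder (u w : E → H) (x : E) : ℝ :=
  ‖w x‖ ^ 2 * (2 * |gradInner u w x| + energyDensity w x) +
    (‖w x‖ ^ 2) ^ 2 * (energyDensity u x + 2 * |gradInner u w x| + energyDensity w x)

lemma energyRemainder_nonneg (u w : E → H) (x : E) :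
    0 ≤ energyRemainder u w x := by
  have := energyDensity_nonneg u x
  have := energyDensity_nonneg w x
  unfold energyRemainder
  positivity

end RemainderEstimate

section Variation

variable {m n : ℕ} {f : Euc m → Sph n} {W : Euc m → Euc (n + 1)}

/-- A smooth, compactly supported vector field along `f`. -/
structure IsTangentField (f : Euc m → Sph n) (W : Euc m → Euc (n + 1)) : Prop where
  smooth : ContDiff ℝ ∞ W
  compact : HasCompactSupport W
  tangent : ∀ x, ⟪ambient f x, W x⟫_ℝ = 0

/-- The variation `(f + s W) / |f + s W|` of `f` with velocity `W`. -/
def variation (hW : IsTangentField f W) (s : ℝ) (x : Euc m) : Sph n :=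
  ⟨(√(1 + s ^ 2 * ‖W x‖ ^ 2))⁻¹ • (ambient f x + s • W x), by
    have hsq := norm_add_smul_sq (norm_ambient f x) (hW.tangent x) s
    have hne : ‖ambient f x + s • W x‖ ≠ 0 := by
      rw [← pow_ne_zero_iff two_ne_zero, hsq]
      positivity
    rw [mem_sphere_zero_iff_norm, norm_smul, norm_inv, Real.norm_of_nonneg (Real.sqrt_nonneg _),
      ← hsq, Real.sqrt_sq (norm_nonneg _), inv_mul_cancel₀ hne]⟩

lemma contDiff_variation_uncurried (hf : IsSmooth f) (hW : IsTangentField f W) :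
    ContDiff ℝ ∞ (fun p : ℝ × Euc m => ambient (variation hW p.1) p.2) := by
  have hden : ContDiff ℝ ∞ (fun p : ℝ × Euc m => 1 + p.1 ^ 2 * ‖W p.2‖ ^ 2) :=
    contDiff_const.add ((contDiff_fst.pow 2).mul ((hW.smooth.comp contDiff_snd).norm_sq ℝ))
  exact ((hden.sqrt fun p => by positivity).inv fun p => by positivity).smul
    (((contDiff_ambient hf).comp contDiff_snd).add
      (contDiff_fst.smul (hW.smooth.comp contDiff_snd)))

lemma contMDiff_variation (hf : IsSmooth f) (hW : IsTangentField f W) :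
    ContMDiff 𝓘(ℝ, ℝ × Euc m) (𝓡 n) ∞ (fun p : ℝ × Euc m => variation hW p.1 p.2) :=
  have : Fact (Module.finrank ℝ (Euc (n + 1)) = n + 1) := ⟨by simp⟩
  ContMDiff.codRestrict_sphere (contDiff_variation_uncurried hf hW).contMDiff _

lemma isSmooth_variation (hf : IsSmooth f) (hW : IsTangentField f W) (s : ℝ) :
    IsSmooth (variation hW s) :=
  have hs : ContDiff ℝ ∞ fun x : Euc m => (s, x) := contDiff_const.prodMk contDiff_id
  (contMDiff_variation hf hW).comp hs.contMDiff

lemma variation_eq_of_eq_zero (hW : IsTangentField f W) (s : ℝ) {x : Euc m} (hx : W x = 0) :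
    variation hW s x = f x :=
  Subtype.ext (by simp [variation, hx, ambient])

lemma variation_zero (hW : IsTangentField f W) : variation hW 0 = f :=
  funext fun x => Subtype.ext (by simp [variation, ambient])

lemma isCompactVariation_variation (hf : IsSmooth f) (hW : IsTangentField f W) :
    IsCompactVariation f (variation hW) :=
  ⟨contMDiff_variation hf hW, variation_zero hW, tsupport W, hW.compact, fun s _ hx =>
    variation_eq_of_eq_zero hW s (image_eq_zero_of_notMem_tsupport hx)⟩

lemma energyDensity_variation_le (hf : IsSmooth f) (hW : IsTangentField f W) {s : ℝ}
    (hs : |s| ≤ 1) (x : Euc m) :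
    energyDensity (ambient (variation hW s)) x ≤ energyDensity (ambient f) x +
      2 * s * gradInner (ambient f) W x +
      s ^ 2 * secondVariationDensity (ambient f) W x +
      |s| ^ 3 * energyRemainder (ambient f) W x := by
  have hdu : DifferentiableAt ℝ (ambient f) x := (contDiff_ambient hf).differentiable (by simp) x
  have hdW : DifferentiableAt ℝ W x := hW.smooth.differentiable (by simp) x
  have hadd := energyDensity_add_smul hdu hdW s
  have hdr : DifferentiableAt ℝ (fun x => (√(1 + s ^ 2 * ‖W x‖ ^ 2))⁻¹) x :=
    ((((hdW.norm_sq ℝ).const_mul _).const_add 1).sqrt (by positivity)).inv (by positivity)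
  have hle := energyDensity_smul_le_of_norm_eq_one hdr (hdu.fun_add (hdW.fun_const_smul s))
    (by positivity) (norm_ambient (variation hW s))
  rw [hadd, inv_pow, Real.sq_sqrt (by positivity)] at hle
  exact hle.trans (inv_one_add_mul_le hs (energyDensity_nonneg _ x)
    (sq_nonneg _) (hadd ▸ energyDensity_nonneg _ x))

lemma gradInner_gauss_smul (hf : IsSoliton f) (hW : IsTangentField f W) (y : Euc m) {a : ℝ}
    (ha : 0 < 1 + a) (x : Euc m) :
    (1 + a) * (gradInner (ambient f) (fun x => gauss y (1 + a) x • W x) x +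
        ⟪Laplacian.laplacian (ambient f) x, gauss y (1 + a) x • W x⟫_ℝ) =
      (1 + a) * (gradInner (ambient f) W x * gauss y (1 + a) x) +
        2⁻¹ * ⟪W x, a • fderiv ℝ (ambient f) x x + fderiv ℝ (ambient f) x y⟫_ℝ *
          gauss y (1 + a) x := by
  have hgrad : gradient (gauss y (1 + a)) x = -(gauss y (1 + a) x / (2 * (1 + a))) • (x - y) :=
    ext_inner_right ℝ fun v => by
      rw [inner_gradient_left, fderiv_gauss, real_inner_smul_left]
      ring
  rw [gradInner_smul_right ((contDiff_gauss (k := 1) y _).differentiable (by simp) x)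
    (hW.smooth.differentiable (by simp) x), hgrad, inner_smul_right,
    hf.inner_laplacian x (hW.tangent x), map_smul, map_smul, map_sub, real_inner_smul_left,
    real_inner_smul_left, inner_sub_left, inner_add_right, inner_smul_right,
    real_inner_comm (fderiv ℝ (ambient f) x x), real_inner_comm (fderiv ℝ (ambient f) x y)]
  field_simp
  ring

lemma IsSoliton.integral_gradInner_mul_gauss (hf : IsSoliton f) (hW : IsTangentField f W)
    (y : Euc m) {a : ℝ} (ha : 0 < 1 + a) :
    (1 + a) * ∫ x, gradInner (ambient f) W x * gauss y (1 + a) x =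
      -∫ x, 2⁻¹ * ⟪W x, a • fderiv ℝ (ambient f) x x + fderiv ℝ (ambient f) x y⟫_ℝ *
        gauss y (1 + a) x := by
  have hu := contDiff_ambient hf.1
  have := hu.continuous_fderiv (by simp)
  have := hW.smooth.continuous
  have := (contDiff_gradInner (l := 0) hu hW.smooth).continuous
  have hint : ∀ {h : Euc m → ℝ}, Continuous h → (∀ x ∉ tsupport W, h x = 0) → Integrable h :=
    fun hh h0 => hh.integrable_of_hasCompactSupport (HasCompactSupport.intro hW.compact h0)
  have hvar := integral_gradInner_add_inner_laplacian (hu.of_le ENat.LEInfty.out)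
    ((contDiff_gauss y (1 + a)).smul (hW.smooth.of_le ENat.LEInfty.out)) hW.compact.smul_left
  rw [eq_neg_iff_add_eq_zero, ← integral_const_mul, ← integral_add, ← mul_zero (1 + a), ← hvar,
    ← integral_const_mul]
  · exact integral_congr_ae (Eventually.of_forall fun x => (gradInner_gauss_smul hf hW y ha x).symm)
  · refine hint (by fun_prop) fun x hx => ?_
    simp [gradInner, fderiv_of_notMem_tsupport ℝ hx]
  · refine hint (by fun_prop) fun x hx => ?_
    simp [image_eq_zero_of_notMem_tsupport hx]

end Variation

section CompactSupport

variable {E H : Type*} [NormedAddCommGroup E] [InnerProductSpace ℝ E] [FiniteDimensional ℝ E]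
  [NormedAddCommGroup H] [InnerProductSpace ℝ H]

lemma continuous_secondVariationDensity {u w : E → H} (hu : ContDiff ℝ 1 u) (hw : ContDiff ℝ 1 w) :
    Continuous (secondVariationDensity u w) := by
  have := (contDiff_energyDensity (l := 0) hu).continuous
  have := (contDiff_energyDensity (l := 0) hw).continuous
  have := hw.continuous
  unfold secondVariationDensity
  fun_prop

lemma continuous_energyRemainder {u w : E → H} (hu : ContDiff ℝ 1 u) (hw : ContDiff ℝ 1 w) :
    Continuous (energyRemainder u w) := by
  have := (contDiff_gradInner (l := 0) hu hw).continuous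
  have := (contDiff_energyDensity (l := 0) hu).continuous
  have := (contDiff_energyDensity (l := 0) hw).continuous
  have := hw.continuous
  unfold energyRemainder
  fun_prop

variable {w : E → H} {x : E}

lemma gradInner_eq_zero_of_notMem_tsupport (u : E → H) (hx : x ∉ tsupport w) :
    gradInner u w x = 0 := by
  simp [gradInner, fderiv_of_notMem_tsupport ℝ hx]

lemma secondVariationDensity_eq_zero_of_notMem_tsupport (u : E → H) (hx : x ∉ tsupport w) :
    secondVariationDensity u w x = 0 := by
  simp [secondVariationDensity, energyDensity, gradInner_eq_zero_of_notMem_tsupport w hx,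
    image_eq_zero_of_notMem_tsupport hx]

lemma energyRemainder_eq_zero_of_notMem_tsupport (u : E → H) (hx : x ∉ tsupport w) :
    energyRemainder u w x = 0 := by
  simp [energyRemainder, image_eq_zero_of_notMem_tsupport hx]

end CompactSupport

section GaussEnergy

variable {E : Type*} [NormedAddCommGroup E] [InnerProductSpace ℝ E] [FiniteDimensional ℝ E]
  [MeasurableSpace E] [BorelSpace E]

lemma gaussEnergy_add {e₁ e₂ : E → ℝ} {x₀ : E} {t : ℝ}
    (h₁ : Integrable fun x => e₁ x * gauss x₀ t x) (h₂ : Integrable fun x => e₂ x * gauss x₀ t x) :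
    gaussEnergy (fun x => e₁ x + e₂ x) x₀ t = gaussEnergy e₁ x₀ t + gaussEnergy e₂ x₀ t := by
  simp only [gaussEnergy, add_mul]
  rw [integral_add h₁ h₂, mul_add]

lemma gaussEnergy_const_mul (c : ℝ) (e : E → ℝ) (x₀ : E) (t : ℝ) :
    gaussEnergy (fun x => c * e x) x₀ t = c * gaussEnergy e x₀ t := by
  simp only [gaussEnergy, mul_assoc, integral_const_mul]
  ring

/-- In dimension at least two `t G_{x₀,t}` is uniformly bounded for `t ≥ 1`, while for `t ≤ 1` the
Gaussian has mass one. -/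
lemma exists_gaussEnergy_le_of_hasCompactSupport (hdim : 2 ≤ Module.finrank ℝ E) {b : E → ℝ}
    (hb : Continuous b) (hc : HasCompactSupport b) :
    ∃ L : ℝ, ∀ (x₀ : E) (t : ℝ), 0 < t → gaussEnergy b x₀ t ≤ L := by
  obtain ⟨C, hC⟩ := hc.exists_bound_of_continuous hb
  have hC0 : 0 ≤ C := (norm_nonneg _).trans (hC 0)
  have hI0 : 0 ≤ ∫ x, ‖b x‖ := integral_nonneg fun x => norm_nonneg _
  refine ⟨C + ∫ x, ‖b x‖, fun x₀ t ht => ?_⟩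
  have hbG : Integrable fun x => b x * gauss x₀ t x :=
    (hb.mul (continuous_gauss x₀ t)).integrable_of_hasCompactSupport hc.mul_right
  rcases le_total t 1 with ht1 | ht1
  · have hmass : ∫ x, b x * gauss x₀ t x ≤ C := by
      rw [← mul_one C, ← integral_gauss x₀ ht, ← integral_const_mul]
      exact integral_mono hbG ((integrable_gauss x₀ ht).const_mul C) fun x =>
        mul_le_mul_of_nonneg_right ((Real.le_norm_self _).trans (hC x)) (gauss_pos x₀ ht x).le
    calc gaussEnergy b x₀ t ≤ t / 2 * C := mul_le_mul_of_nonneg_left hmass (by positivity)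
      _ ≤ 1 * C := by gcongr; linarith
      _ ≤ C + ∫ x, ‖b x‖ := by linarith
  · have hden : t ≤ (4 * Real.pi * t) ^ ((Module.finrank ℝ E : ℝ) / 2) := by
      have hone : t ≤ 4 * Real.pi * t :=
        le_mul_of_one_le_left ht.le (by linarith [Real.pi_gt_three])
      have hexp : (1 : ℝ) ≤ (Module.finrank ℝ E : ℝ) / 2 := by
        rw [one_le_div two_pos]
        exact_mod_cast hdim
      exact hone.trans (Real.self_le_rpow_of_one_le (ht1.trans hone) hexp)
    have hdecay : ∫ x, b x * gauss x₀ t x ≤ t⁻¹ * ∫ x, ‖b x‖ := by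
      rw [mul_comm, ← integral_mul_const]
      exact integral_mono hbG ((hb.integrable_of_hasCompactSupport hc).norm.mul_const _) fun x =>
        mul_le_mul (Real.le_norm_self _) ((gauss_le x₀ ht x).trans (inv_anti₀ ht hden))
          (gauss_pos x₀ ht x).le (norm_nonneg _)
    calc gaussEnergy b x₀ t ≤ t / 2 * (t⁻¹ * ∫ x, ‖b x‖) :=
          mul_le_mul_of_nonneg_left hdecay (by positivity)
      _ = 2⁻¹ * ∫ x, ‖b x‖ := by field_simp
      _ ≤ C + ∫ x, ‖b x‖ := by linarith

variable {H : Type*} [NormedAddCommGroup H] [InnerProductSpace ℝ H]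

/-- The quadratic form whose negativity makes a tangent field destabilizing. -/
def stabilityForm (u w : E → H) : ℝ :=
  gaussEnergy (fun x => 3 / 2 * ‖w x‖ ^ 2 + secondVariationDensity u w x) 0 1

end GaussEnergy

section NearEstimate

lemma inner_sub_decay_le {V : Type*} [NormedAddCommGroup V] [InnerProductSpace ℝ V] (w p z : V)
    {κ : ℝ} (hκ : 0 < κ) (s a : ℝ) :
    s * -(2⁻¹ * ⟪w, a • p + z⟫_ℝ) - κ / 2 * (a ^ 2 / 4 * ‖p‖ ^ 2 + 2 * a / 3 * ⟪p, z⟫_ℝ +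
      2⁻¹ * ‖z‖ ^ 2) ≤ s ^ 2 * (3 / (4 * κ) * ‖w‖ ^ 2) := by
  obtain ⟨c, rfl⟩ : ∃ c, s = κ * c := ⟨s / κ, by field_simp⟩
  have h₁ := real_inner_self_nonneg (x := (a / 2) • p + (2 / 3 : ℝ) • z + c • w)
  have h₂ := real_inner_self_nonneg (x := (1 / 6 : ℝ) • z - (c / 2) • w)
  simp only [inner_add_left, inner_add_right, inner_sub_left, inner_sub_right, inner_smul_left,
    inner_smul_right, conj_trivial, real_inner_self_eq_norm_sq, real_inner_comm p z,
    real_inner_comm w p, real_inner_comm w z] at h₁ h₂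
  rw [inner_add_right, inner_smul_right]
  have hsq : (κ * c) ^ 2 * (3 / (4 * κ) * ‖w‖ ^ 2) = κ * (3 / 4 * c ^ 2 * ‖w‖ ^ 2) := by
    field_simp
  rw [hsq, ← sub_nonneg]
  refine (mul_nonneg hκ.le (add_nonneg (mul_nonneg one_half_pos.le h₁) h₂)).trans_eq ?_
  ring

variable {m n : ℕ} {f : Euc m → Sph n} {W : Euc m → Euc (n + 1)}

lemma IsTangentField.integrable_mul_gauss (hW : IsTangentField f W) {h : Euc m → ℝ}
    (hh : Continuous h) (h0 : ∀ x ∉ tsupport W, h x = 0) (y : Euc m) (t : ℝ) :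
    Integrable (fun x => h x * gauss y t x) :=
  (hh.mul (continuous_gauss y t)).integrable_of_hasCompactSupport
    (HasCompactSupport.intro hW.compact fun x hx => by simp [h0 x hx])

/-- The gain in the Gaussian energy from moving the centre absorbs the first variation. -/
lemma IsSoliton.first_variation_sub_decay_le (hf : IsSoliton f) (hW : IsTangentField f W)
    {κ : ℝ} (hκ : 0 < κ) (s : ℝ) (y : Euc m) {a : ℝ} (ha : 0 < 1 + a) :
    2 * s * gaussEnergy (gradInner (ambient f) W) y (1 + a) - κ / 2 * ∫ x in tsupport W,
        decayDensity (ambient f) y a x * gauss y (1 + a) x ≤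
      s ^ 2 * (3 / (4 * κ) * ∫ x, ‖W x‖ ^ 2 * gauss y (1 + a) x) := by
  have hu := contDiff_ambient hf.1
  have := hu.continuous_fderiv (by simp)
  have := hW.smooth.continuous
  have := continuous_decayDensity (hu.of_le ENat.LEInfty.out) y a
  have hint : ∀ {h : Euc m → ℝ}, Continuous h → IntegrableOn h (tsupport W) := fun hh =>
    hh.continuousOn.integrableOn_compact hW.compact
  have hfirst : 2 * s * gaussEnergy (gradInner (ambient f) W) y (1 + a) = ∫ x in tsupport W,
      s * -(2⁻¹ * ⟪W x, a • fderiv ℝ (ambient f) x x + fderiv ℝ (ambient f) x y⟫_ℝ) *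
        gauss y (1 + a) x := by
    rw [setIntegral_eq_integral_of_forall_compl_eq_zero
      fun x hx => by simp [image_eq_zero_of_notMem_tsupport hx]]
    simp only [mul_assoc s, neg_mul, integral_const_mul, integral_neg]
    rw [← hf.integral_gradInner_mul_gauss hW y ha, gaussEnergy]
    ring
  have hlast : s ^ 2 * (3 / (4 * κ) * ∫ x, ‖W x‖ ^ 2 * gauss y (1 + a) x) =
      ∫ x in tsupport W, s ^ 2 * (3 / (4 * κ) * (‖W x‖ ^ 2 * gauss y (1 + a) x)) := by
    rw [setIntegral_eq_integral_of_forall_compl_eq_zero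
      fun x hx => by simp [image_eq_zero_of_notMem_tsupport hx]]
    simp only [integral_const_mul]
  rw [hfirst, hlast, ← integral_const_mul, ← integral_sub]
  rotate_left
  · exact hint (by fun_prop)
  · exact hint (by fun_prop)
  refine integral_mono (hint (by fun_prop)) (hint (by fun_prop)) fun x => ?_
  have hle := mul_le_mul_of_nonneg_right (inner_sub_decay_le (W x) (fderiv ℝ (ambient f) x x)
    (fderiv ℝ (ambient f) x y) hκ s a) (gauss_pos y ha x).le
  simp only [decayDensity]
  linarith

lemma IsTangentField.functionalF_variation_le (hW : IsTangentField f W) (hf : IsSmooth f)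
    (hfin : entropy f ≠ ⊤) {s : ℝ} (hs : |s| ≤ 1) (y : Euc m) {t : ℝ} (ht : 0 < t) :
    functionalF y t (variation hW s) ≤ ENNReal.ofReal
      (gaussEnergy (energyDensity (ambient f)) y t +
        2 * s * gaussEnergy (gradInner (ambient f) W) y t +
        s ^ 2 * gaussEnergy (secondVariationDensity (ambient f) W) y t +
        |s| ^ 3 * gaussEnergy (energyRemainder (ambient f) W) y t) := by
  have hu : ContDiff ℝ 1 (ambient f) := (contDiff_ambient hf).of_le ENat.LEInfty.out
  have hw : ContDiff ℝ 1 W := hW.smooth.of_le ENat.LEInfty.out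
  have hi₀ := integrable_energyDensity_mul_gauss hf hfin y ht
  have hi₁ := hW.integrable_mul_gauss ((contDiff_gradInner (l := 0) hu hw).continuous.const_mul
    (2 * s)) (fun x hx => by simp [gradInner_eq_zero_of_notMem_tsupport _ hx]) y t
  have hi₂ := hW.integrable_mul_gauss ((continuous_secondVariationDensity hu hw).const_mul
    (s ^ 2)) (fun x hx => by simp [secondVariationDensity_eq_zero_of_notMem_tsupport _ hx]) y t
  have hi₃ := hW.integrable_mul_gauss ((continuous_energyRemainder hu hw).const_mul
    (|s| ^ 3)) (fun x hx => by simp [energyRemainder_eq_zero_of_notMem_tsupport _ hx]) y t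
  have hi₀₁ := (hi₀.add hi₁).congr (Eventually.of_forall fun x => (add_mul _ _ _).symm)
  have hi₀₂ := (hi₀₁.add hi₂).congr (Eventually.of_forall fun x => (add_mul _ _ _).symm)
  have hi₀₃ := (hi₀₂.add hi₃).congr (Eventually.of_forall fun x => (add_mul _ _ _).symm)
  refine (functionalF_le_ofReal ht (energyDensity_variation_le hf hW hs) hi₀₃).trans_eq ?_
  rw [gaussEnergy_add hi₀₂ hi₃, gaussEnergy_add hi₀₁ hi₂, gaussEnergy_add hi₀ hi₁]
  simp only [gaussEnergy_const_mul]

lemma IsSoliton.eventually_functionalF_variation_le (hf : IsSoliton f) (hfin : entropy f ≠ ⊤)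
    (hW : IsTangentField f W) {κ : ℝ} (hκ0 : 0 < κ) (hκ1 : κ < 1) :
    ∀ᶠ p : Euc m × ℝ in 𝓝 (0, 0), ∀ s : ℝ, |s| ≤ 1 →
      functionalF p.1 (1 + p.2) (variation hW s) ≤ ENNReal.ofReal
        (gaussEnergy (energyDensity (ambient f)) 0 1 +
          s ^ 2 * (3 / (4 * κ) * (∫ x, ‖W x‖ ^ 2 * gauss p.1 (1 + p.2) x) +
            gaussEnergy (secondVariationDensity (ambient f) W) p.1 (1 + p.2)) +
          |s| ^ 3 * gaussEnergy (energyRemainder (ambient f) W) p.1 (1 + p.2)) := by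
  have htime : ∀ᶠ p : Euc m × ℝ in 𝓝 (0, 0), -1 < p.2 :=
    continuousAt_snd.eventually_const_lt (by norm_num)
  filter_upwards [hf.satisfiesSolitonEquation.eventually_gaussEnergy_add_decay_le
    ((contDiff_ambient hf.1).of_le ENat.LEInfty.out) (hasFiniteGaussEnergies_ambient hf.1 hfin)
    hW.compact hκ1, htime] with p hdecay hp s hs
  have ht : 0 < 1 + p.2 := by linarith
  refine (hW.functionalF_variation_le hf.1 hfin hs p.1 ht).trans (ENNReal.ofReal_le_ofReal ?_)
  have hfirst := hf.first_variation_sub_decay_le hW hκ0 s p.1 ht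
  linarith

lemma IsTangentField.continuousAt_integral_mul_gauss (hW : IsTangentField f W) {h : Euc m → ℝ}
    (hh : Continuous h) (h0 : ∀ x ∉ tsupport W, h x = 0) :
    ContinuousAt (fun p : Euc m × ℝ => ∫ x, h x * gauss p.1 (1 + p.2) x) (0, 0) :=
  ContinuousAt.comp' (f := fun p : Euc m × ℝ => (p.1, 1 + p.2))
    (g := fun p : Euc m × ℝ => ∫ x, h x * gauss p.1 p.2 x)
    (HarmonicSoliton.continuousAt_integral_mul_gauss hh.aestronglyMeasurable
      (fun _ => hW.integrable_mul_gauss hh h0 0 _) (by norm_num)) (by fun_prop)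

lemma IsTangentField.continuousAt_gaussEnergy (hW : IsTangentField f W) {h : Euc m → ℝ}
    (hh : Continuous h) (h0 : ∀ x ∉ tsupport W, h x = 0) :
    ContinuousAt (fun p : Euc m × ℝ => gaussEnergy h p.1 (1 + p.2)) (0, 0) :=
  HarmonicSoliton.continuousAt_gaussEnergy hh.aestronglyMeasurable
    (fun _ => hW.integrable_mul_gauss hh h0 0 _) (by norm_num)

lemma IsTangentField.exists_eventually_quadratic_lt (hW : IsTangentField f W) (hf : IsSmooth f)
    (hq : stabilityForm (ambient f) W < 0) :
    ∃ κ : ℝ, 0 < κ ∧ κ < 1 ∧ ∀ᶠ p : Euc m × ℝ in 𝓝 (0, 0),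
      3 / (4 * κ) * (∫ x, ‖W x‖ ^ 2 * gauss p.1 (1 + p.2) x) +
        gaussEnergy (secondVariationDensity (ambient f) W) p.1 (1 + p.2) <
          stabilityForm (ambient f) W / 2 := by
  have hw : ContDiff ℝ 1 W := hW.smooth.of_le ENat.LEInfty.out
  have hdc := continuous_secondVariationDensity ((contDiff_ambient hf).of_le ENat.LEInfty.out) hw
  have hwc : Continuous fun x => ‖W x‖ ^ 2 := by
    have := hw.continuous
    fun_prop
  have hd0 : ∀ x ∉ tsupport W, secondVariationDensity (ambient f) W x = 0 := fun x hx =>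
    secondVariationDensity_eq_zero_of_notMem_tsupport _ hx
  have hw0 : ∀ x ∉ tsupport W, ‖W x‖ ^ 2 = 0 := fun x hx => by
    simp [image_eq_zero_of_notMem_tsupport hx]
  let Φ : ℝ → Euc m × ℝ → ℝ := fun κ p => 3 / (4 * κ) * (∫ x, ‖W x‖ ^ 2 * gauss p.1 (1 + p.2) x) +
    gaussEnergy (secondVariationDensity (ambient f) W) p.1 (1 + p.2)
  have hΦ : ∀ κ, ContinuousAt (Φ κ) (0, 0) := fun κ =>
    (continuousAt_const.mul (hW.continuousAt_integral_mul_gauss hwc hw0)).add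
      (hW.continuousAt_gaussEnergy hdc hd0)
  have hone : Φ 1 (0, 0) = stabilityForm (ambient f) W := by
    have hadd := gaussEnergy_add (hW.integrable_mul_gauss (hwc.const_mul (3 / 2))
      (fun x hx => by rw [hw0 x hx, mul_zero]) 0 1) (hW.integrable_mul_gauss hdc hd0 0 1)
    rw [stabilityForm, hadd, gaussEnergy_const_mul, gaussEnergy]
    simp only [Φ, add_zero]
    ring
  have hκ : ContinuousAt (fun κ : ℝ => Φ κ (0, 0)) 1 :=
    ((continuousAt_const.div (by fun_prop) (by norm_num)).mul continuousAt_const).add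
      continuousAt_const
  obtain ⟨κ, hlt, hκ0, hκ1⟩ := (((hκ.eventually_lt (continuousAt_const
    (y := stabilityForm (ambient f) W / 2)) (by rw [hone]; linarith)).filter_mono
      nhdsWithin_le_nhds).and (Ioo_mem_nhdsLT one_pos)).exists
  exact ⟨κ, hκ0, hκ1, (hΦ κ).eventually_lt continuousAt_const hlt⟩

lemma IsSoliton.exists_nhds_functionalF_variation_le (hf : IsSoliton f) (hfin : entropy f ≠ ⊤)
    (hW : IsTangentField f W) (hq : stabilityForm (ambient f) W < 0) :
    ∃ U ∈ 𝓝 ((0 : Euc m), (0 : ℝ)), ∀ᶠ s : ℝ in 𝓝 0, ∀ p ∈ U,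
      functionalF p.1 (1 + p.2) (variation hW s) ≤ ENNReal.ofReal
        (gaussEnergy (energyDensity (ambient f)) 0 1 +
          s ^ 2 * (stabilityForm (ambient f) W / 4)) := by
  obtain ⟨κ, hκ0, hκ1, hquad⟩ := hW.exists_eventually_quadratic_lt hf.1 hq
  let L := gaussEnergy (energyRemainder (ambient f) W) 0 1 + 1
  have hcubic : ∀ᶠ p : Euc m × ℝ in 𝓝 (0, 0),
      gaussEnergy (energyRemainder (ambient f) W) p.1 (1 + p.2) < L :=
    (hW.continuousAt_gaussEnergy (continuous_energyRemainder ((contDiff_ambient hf.1).of_le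
      ENat.LEInfty.out) (hW.smooth.of_le ENat.LEInfty.out)) fun x hx =>
        energyRemainder_eq_zero_of_notMem_tsupport _ hx).eventually_lt continuousAt_const
      (by simp [L])
  refine ⟨_, (hf.eventually_functionalF_variation_le hfin hW hκ0 hκ1).and (hquad.and hcubic), ?_⟩
  have hsmall : ∀ᶠ s : ℝ in 𝓝 0, |s| * L < -(stabilityForm (ambient f) W / 4) :=
    ContinuousAt.eventually_lt (by fun_prop) continuousAt_const (by simp; linarith)
  have hone : ∀ᶠ s : ℝ in 𝓝 0, |s| < 1 :=
    ContinuousAt.eventually_lt (by fun_prop) continuousAt_const (by simp)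
  filter_upwards [hsmall, hone] with s hsL hs1 p ⟨hF, hp₂, hp₃⟩
  refine (hF s hs1.le).trans (ENNReal.ofReal_le_ofReal ?_)
  have hquad' := mul_le_mul_of_nonneg_left hp₂.le (sq_nonneg s)
  have hcubic' := mul_le_mul_of_nonneg_left hp₃.le (pow_nonneg (abs_nonneg s) 3)
  have hsL' := mul_le_mul_of_nonneg_left hsL.le (sq_nonneg s)
  rw [← mul_assoc, ← sq_abs, ← pow_succ, sq_abs] at hsL'
  linarith

end NearEstimate

section Instability

variable {m n : ℕ} {f : Euc m → Sph n} {W : Euc m → Euc (n + 1)}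

lemma energyDensity_variation_le_add_mul (hf : IsSmooth f) (hW : IsTangentField f W) {s : ℝ}
    (hs : |s| ≤ 1) (x : Euc m) :
    energyDensity (ambient (variation hW s)) x ≤ energyDensity (ambient f) x +
      |s| * (2 * |gradInner (ambient f) W x| + |secondVariationDensity (ambient f) W x| +
        energyRemainder (ambient f) W x) := by
  have hfirst : 2 * s * gradInner (ambient f) W x ≤ |s| * (2 * |gradInner (ambient f) W x|) := by
    have := le_abs_self (s * gradInner (ambient f) W x)
    rw [abs_mul] at this
    linarith
  have hsecond : s ^ 2 * secondVariationDensity (ambient f) W x ≤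
      |s| * |secondVariationDensity (ambient f) W x| := by
    calc _ ≤ |s| ^ 2 * |secondVariationDensity (ambient f) W x| := by
          rw [sq_abs]
          gcongr
          exact le_abs_self _
      _ ≤ _ := mul_le_mul_of_nonneg_right (pow_le_of_le_one (abs_nonneg s) hs two_ne_zero)
        (abs_nonneg _)
  have hthird : |s| ^ 3 * energyRemainder (ambient f) W x ≤
      |s| * energyRemainder (ambient f) W x :=
    mul_le_mul_of_nonneg_right (pow_le_of_le_one (abs_nonneg s) hs three_ne_zero)
      (energyRemainder_nonneg _ _ _)
  linarith [energyDensity_variation_le hf hW hs x]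

lemma exists_functionalF_variation_le_add_mul (hf : IsSmooth f) (hfin : entropy f ≠ ⊤)
    (hm : 2 ≤ m) (hW : IsTangentField f W) :
    ∃ L : ℝ, ∀ s : ℝ, |s| ≤ 1 → ∀ (y : Euc m) (t : ℝ), 0 < t →
      functionalF y t (variation hW s) ≤ ENNReal.ofReal
        (gaussEnergy (energyDensity (ambient f)) y t + |s| * L) := by
  have hu : ContDiff ℝ 1 (ambient f) := (contDiff_ambient hf).of_le ENat.LEInfty.out
  have hw : ContDiff ℝ 1 W := hW.smooth.of_le ENat.LEInfty.out
  let b : Euc m → ℝ := fun x => 2 * |gradInner (ambient f) W x| +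
    |secondVariationDensity (ambient f) W x| + energyRemainder (ambient f) W x
  have hbc : Continuous b := by
    have := (contDiff_gradInner (l := 0) hu hw).continuous
    have := continuous_secondVariationDensity hu hw
    have := continuous_energyRemainder hu hw
    fun_prop
  have hb0 : ∀ x ∉ tsupport W, b x = 0 := fun x hx => by
    simp [b, gradInner_eq_zero_of_notMem_tsupport _ hx, energyRemainder_eq_zero_of_notMem_tsupport _
      hx, secondVariationDensity_eq_zero_of_notMem_tsupport _ hx]
  obtain ⟨L, hL⟩ := exists_gaussEnergy_le_of_hasCompactSupport (by simpa using hm) hbc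
    (HasCompactSupport.intro hW.compact hb0)
  refine ⟨L, fun s hs y t ht => ?_⟩
  have hi₀ := integrable_energyDensity_mul_gauss hf hfin y ht
  have hi₁ := hW.integrable_mul_gauss (hbc.const_mul |s|)
    (fun x hx => by rw [hb0 x hx, mul_zero]) y t
  refine (functionalF_le_ofReal ht (energyDensity_variation_le_add_mul hf hW hs)
    ((hi₀.add hi₁).congr (Eventually.of_forall fun x => (add_mul _ _ _).symm))).trans
      (ENNReal.ofReal_le_ofReal ?_)
  rw [gaussEnergy_add hi₀ hi₁, gaussEnergy_const_mul]
  gcongr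
  exact hL y t ht

lemma IsSoliton.eventually_entropy_variation_lt (hf : IsSoliton f) (hfin : entropy f ≠ ⊤)
    (hm : 2 ≤ m) (hcyl : ¬ IsCylindrical f)
    (hpos : 0 < gaussEnergy (energyDensity (ambient f)) 0 1) (hW : IsTangentField f W)
    (hq : stabilityForm (ambient f) W < 0) :
    ∀ᶠ s in 𝓝[≠] (0 : ℝ), entropy (variation hW s) < entropy f := by
  have : Nontrivial (Euc m) := Module.nontrivial_of_finrank_pos (R := ℝ) (by simp; omega)
  let F₀ := gaussEnergy (energyDensity (ambient f)) 0 1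
  let q := stabilityForm (ambient f) W
  obtain ⟨U, hU, hnear⟩ := hf.exists_nhds_functionalF_variation_le hfin hW hq
  obtain ⟨M, hM, hfar⟩ := hf.satisfiesSolitonEquation.exists_gaussEnergy_le_of_notMem_nhds
    ((contDiff_ambient hf.1).of_le ENat.LEInfty.out) (hasFiniteGaussEnergies_ambient hf.1 hfin)
    (fun ζ hζ => by_contra fun h0 => hcyl ⟨ζ, h0, hζ⟩) hU
  obtain ⟨L, hL⟩ := exists_functionalF_variation_le_add_mul hf.1 hfin hm hW
  have hone : ∀ᶠ s : ℝ in 𝓝 0, |s| < 1 :=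
    ContinuousAt.eventually_lt (by fun_prop) continuousAt_const (by simp)
  have hsmall : ∀ᶠ s : ℝ in 𝓝 0, M + |s| * L < (M + F₀) / 2 :=
    ContinuousAt.eventually_lt (by fun_prop) continuousAt_const (by simp; linarith)
  filter_upwards [(hnear.and (hone.and hsmall)).filter_mono nhdsWithin_le_nhds,
    self_mem_nhdsWithin] with s ⟨hnear, hs1, hsL⟩ hs
  have hle : entropy (variation hW s) ≤
      ENNReal.ofReal (max (F₀ + s ^ 2 * (q / 4)) ((M + F₀) / 2)) := by
    refine iSup₂_le fun y t => iSup_le fun ht => ?_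
    obtain ⟨a, rfl⟩ : ∃ a, t = 1 + a := ⟨t - 1, by ring⟩
    by_cases hp : (y, a) ∈ U
    · exact (hnear _ hp).trans (ENNReal.ofReal_le_ofReal (le_max_left _ _))
    · refine (hL s hs1.le y _ ht).trans (ENNReal.ofReal_le_ofReal (le_max_of_le_right ?_))
      have := hfar _ hp (by simpa using neg_lt_iff_pos_add'.2 ht)
      linarith
  refine hle.trans_lt ?_
  rw [hf.entropy_eq hfin, ENNReal.ofReal_lt_ofReal_iff hpos]
  have hs2 : 0 < s ^ 2 := sq_pos_of_ne_zero hs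
  exact max_lt (add_lt_of_neg_right _ (mul_neg_of_pos_of_neg hs2 (by linarith))) (by linarith)

end Instability

section LowDimension

variable {E H : Type*} [NormedAddCommGroup E] [InnerProductSpace ℝ E] [NormedAddCommGroup H]
  [InnerProductSpace ℝ H]

lemma gauss_le_rpow_mul_gauss (x₀ x : E) {s t : ℝ} (hs : 0 < s) (hst : s ≤ t) :
    gauss x₀ s x ≤ (t / s) ^ ((Module.finrank ℝ E : ℝ) / 2) * gauss x₀ t x := by
  have ht := hs.trans_le hst
  have hscale : (4 * Real.pi * t) ^ ((Module.finrank ℝ E : ℝ) / 2) =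
      (t / s) ^ ((Module.finrank ℝ E : ℝ) / 2) *
        (4 * Real.pi * s) ^ ((Module.finrank ℝ E : ℝ) / 2) := by
    rw [← Real.mul_rpow (by positivity) (by positivity)]
    congr 1
    field_simp
  have hexp : -‖x - x₀‖ ^ 2 / (4 * s) ≤ -‖x - x₀‖ ^ 2 / (4 * t) := by
    rw [neg_div, neg_div]
    gcongr
  rw [gauss, gauss, hscale, ← mul_div_assoc, mul_div_mul_left _ _ (by positivity)]
  gcongr

variable [FiniteDimensional ℝ E] [MeasurableSpace E] [BorelSpace E]

/-- The Gaussians satisfy `G_{0,1} ≤ 2 G_{0,4}`, so the energy would double from scale `1` to scale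
`4`, where it is no larger. -/
lemma SatisfiesSolitonEquation.gaussEnergy_nonpos {u : E → H} (hsol : SatisfiesSolitonEquation u)
    (hu : ContDiff ℝ 2 u) (hfin : HasFiniteGaussEnergies u) (hdim : Module.finrank ℝ E ≤ 1) :
    gaussEnergy (energyDensity u) 0 1 ≤ 0 := by
  have hfour : ((4 : ℝ) / 1) ^ ((Module.finrank ℝ E : ℝ) / 2) ≤ 2 := by
    calc ((4 : ℝ) / 1) ^ ((Module.finrank ℝ E : ℝ) / 2) ≤ 4 ^ ((1 : ℝ) / 2) := by
          rw [div_one]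
          gcongr
          · norm_num
          · exact_mod_cast hdim
      _ = 2 := by
          rw [← Real.sqrt_eq_rpow, show (4 : ℝ) = 2 ^ 2 by norm_num, Real.sqrt_sq zero_le_two]
  have hgauss : ∀ x : E, gauss 0 1 x ≤ 2 * gauss 0 4 x := fun x =>
    (gauss_le_rpow_mul_gauss 0 x one_pos (by norm_num)).trans
      (mul_le_mul_of_nonneg_right hfour (gauss_pos 0 four_pos x).le)
  have hdouble : ∫ x, energyDensity u x * gauss 0 1 x ≤
      2 * ∫ x, energyDensity u x * gauss 0 4 x := by
    rw [← integral_const_mul]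
    refine integral_mono (hfin 0 one_pos) ((hfin 0 four_pos).const_mul 2) fun x => ?_
    exact (mul_le_mul_of_nonneg_left (hgauss x) (energyDensity_nonneg u x)).trans_eq
      (mul_left_comm _ _ _)
  have hmono := hsol.gaussEnergy_le hu hfin 0 four_pos
  unfold gaussEnergy at hmono ⊢
  linarith

end LowDimension

section ProjectedField

variable {E H ι : Type*} [NormedAddCommGroup H] [InnerProductSpace ℝ H] [Fintype ι]

/-- The constant vector `ξ`, projected to the tangent spaces of the unit sphere along `u` and
multiplied by the function `η`. -/
def projectedField (u : E → H) (η : E → ℝ) (ξ : H) (x : E) : H := η x • (ξ - ⟪u x, ξ⟫_ℝ • u x)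

lemma hasCompactSupport_projectedField [TopologicalSpace E] (u : E → H) {η : E → ℝ}
    (hc : HasCompactSupport η) (ξ : H) : HasCompactSupport (projectedField u η ξ) :=
  hc.smul_right

lemma norm_smul_sub_smul_sq {u d : H} (hu : ‖u‖ = 1) (hd : ⟪u, d⟫_ℝ = 0) (ξ : H) (c h : ℝ) :
    ‖c • (ξ - ⟪u, ξ⟫_ℝ • u) - h • (⟪d, ξ⟫_ℝ • u + ⟪u, ξ⟫_ℝ • d)‖ ^ 2 =
      c ^ 2 * (‖ξ‖ ^ 2 - ⟪u, ξ⟫_ℝ ^ 2) + h ^ 2 * (⟪d, ξ⟫_ℝ ^ 2 + ⟪u, ξ⟫_ℝ ^ 2 * ‖d‖ ^ 2) -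
        2 * c * h * (⟪u, ξ⟫_ℝ * ⟪ξ, d⟫_ℝ) := by
  rw [← real_inner_self_eq_norm_sq, ← real_inner_self_eq_norm_sq ξ, ← real_inner_self_eq_norm_sq d]
  simp only [inner_sub_left, inner_sub_right, inner_add_left, inner_add_right, inner_smul_left,
    inner_smul_right, conj_trivial, hd, real_inner_comm u d, real_inner_comm u ξ,
    real_inner_comm ξ d, real_inner_self_eq_norm_sq u, hu]
  ring

lemma sum_norm_smul_sub_smul_sq (b : OrthonormalBasis ι ℝ H) {u d : H} (hu : ‖u‖ = 1)
    (hd : ⟪u, d⟫_ℝ = 0) (c h : ℝ) :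
    ∑ i, ‖c • (b i - ⟪u, b i⟫_ℝ • u) - h • (⟪d, b i⟫_ℝ • u + ⟪u, b i⟫_ℝ • d)‖ ^ 2 =
      (Fintype.card ι - 1) * c ^ 2 + 2 * (h ^ 2 * ‖d‖ ^ 2) := by
  simp only [norm_smul_sub_smul_sq hu hd, b.norm_eq_one, one_pow, Finset.sum_sub_distrib,
    Finset.sum_add_distrib, ← Finset.mul_sum, ← Finset.sum_mul, b.sum_sq_inner_left,
    b.sum_inner_mul_inner, hu, hd, Finset.sum_const, Finset.card_univ, nsmul_eq_mul]
  ring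

lemma sum_norm_projectedField_sq (b : OrthonormalBasis ι ℝ H) {u : E → H}
    (hu : ∀ x, ‖u x‖ = 1) (η : E → ℝ) (x : E) :
    ∑ i, ‖projectedField u η (b i) x‖ ^ 2 = (Fintype.card ι - 1) * η x ^ 2 := by
  simpa [projectedField] using
    sum_norm_smul_sub_smul_sq b (hu x) (inner_zero_right _) (η x) 0

variable [NormedAddCommGroup E] [InnerProductSpace ℝ E]

lemma contDiff_projectedField {k : WithTop ℕ∞} {u : E → H} {η : E → ℝ} (hu : ContDiff ℝ k u)
    (hη : ContDiff ℝ k η) (ξ : H) : ContDiff ℝ k (projectedField u η ξ) :=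
  hη.smul (contDiff_const.sub ((hu.inner ℝ contDiff_const).smul hu))

lemma fderiv_projectedField {u : E → H} {η : E → ℝ} {x : E} (hu : DifferentiableAt ℝ u x)
    (hη : DifferentiableAt ℝ η x) (ξ : H) (v : E) :
    fderiv ℝ (projectedField u η ξ) x v =
      fderiv ℝ η x v • (ξ - ⟪u x, ξ⟫_ℝ • u x) -
        η x • (⟪fderiv ℝ u x v, ξ⟫_ℝ • u x + ⟪u x, ξ⟫_ℝ • fderiv ℝ u x v) := by
  have hinner : DifferentiableAt ℝ (fun y => ⟪u y, ξ⟫_ℝ) x := hu.inner ℝ (by fun_prop)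
  unfold projectedField
  rw [fderiv_fun_smul hη (by fun_prop), fderiv_const_sub, fderiv_fun_smul hinner hu]
  simp only [add_apply, smul_apply, neg_apply, ContinuousLinearMap.smulRight_apply,
    fderiv_inner_apply ℝ hu (differentiableAt_const ξ), fderiv_fun_const, Pi.zero_apply,
    zero_apply, inner_zero_right, zero_add]
  module

variable [FiniteDimensional ℝ E] {u : E → H} (b : OrthonormalBasis ι ℝ H) (hu : ∀ x, ‖u x‖ = 1)
  {η : E → ℝ} {x : E}
include hu

lemma sum_energyDensity_projectedField (hd : DifferentiableAt ℝ u x)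
    (hη : DifferentiableAt ℝ η x) :
    ∑ i, energyDensity (projectedField u η (b i)) x =
      (Fintype.card ι - 1) * energyDensity η x + 2 * (η x ^ 2 * energyDensity u x) := by
  simp only [energyDensity_eq_sum_norm_sq (stdOrthonormalBasis ℝ E),
    fderiv_projectedField hd hη]
  rw [Finset.sum_comm]
  simp only [sum_norm_smul_sub_smul_sq b (hu x) (inner_fderiv_eq_zero_of_norm_eq_one hu hd _),
    Finset.sum_add_distrib, ← Finset.mul_sum, Real.norm_eq_abs, sq_abs]

lemma sum_secondVariationDensity_projectedField (hd : DifferentiableAt ℝ u x)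
    (hη : DifferentiableAt ℝ η x) :
    ∑ i, (3 / 2 * ‖projectedField u η (b i) x‖ ^ 2 +
        secondVariationDensity u (projectedField u η (b i)) x) =
      (Fintype.card ι - 1) * (3 / 2 * η x ^ 2 + energyDensity η x) -
        (Fintype.card ι - 3) * (η x ^ 2 * energyDensity u x) := by
  simp only [secondVariationDensity, Finset.sum_add_distrib, Finset.sum_sub_distrib,
    ← Finset.mul_sum, sum_norm_projectedField_sq b hu, sum_energyDensity_projectedField b hu hd hη]
  ring

end ProjectedField

section Destabilizing

variable {E H ι : Type*} [NormedAddCommGroup E] [InnerProductSpace ℝ E] [FiniteDimensional ℝ E]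
  [NormedAddCommGroup H] [InnerProductSpace ℝ H] [Fintype ι]

lemma energyDensity_le (u : E → H) (x : E) :
    energyDensity u x ≤ Module.finrank ℝ E * ‖fderiv ℝ u x‖ ^ 2 := by
  rw [energyDensity_eq_sum_norm_sq (stdOrthonormalBasis ℝ E)]
  refine (Finset.sum_le_card_nsmul _ _ (‖fderiv ℝ u x‖ ^ 2) fun i _ => ?_).trans_eq (by simp)
  gcongr
  simpa using (fderiv ℝ u x).le_opNorm (stdOrthonormalBasis ℝ E i)

variable [MeasurableSpace E] [BorelSpace E] {u : E → H}

lemma integrable_stabilityForm {w : E → H} (hu : ContDiff ℝ 1 u) (hw : ContDiff ℝ 1 w)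
    (hc : HasCompactSupport w) :
    Integrable fun x => (3 / 2 * ‖w x‖ ^ 2 + secondVariationDensity u w x) * gauss 0 1 x := by
  have := hw.continuous
  have := continuous_secondVariationDensity hu hw
  refine integrable_of_eq_zero_off_tsupport hc (by fun_prop) fun x hx => ?_
  simp [secondVariationDensity_eq_zero_of_notMem_tsupport u hx,
    image_eq_zero_of_notMem_tsupport hx]

lemma integrable_sq_add_energyDensity_mul_gauss {η : E → ℝ} (hη : ContDiff ℝ 1 η)
    (hc : HasCompactSupport η) :
    Integrable fun x => (3 / 2 * η x ^ 2 + energyDensity η x) * gauss 0 1 x := by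
  have := hη.continuous
  have := (contDiff_energyDensity (l := 0) hη).continuous
  refine integrable_of_eq_zero_off_tsupport hc (by fun_prop) fun x hx => ?_
  simp [energyDensity, gradInner_eq_zero_of_notMem_tsupport η hx,
    image_eq_zero_of_notMem_tsupport hx]

variable (b : OrthonormalBasis ι ℝ H) (hu : ∀ x, ‖u x‖ = 1) (hdiff : ContDiff ℝ 1 u)
include hu hdiff

lemma sum_stabilityForm_projectedField {η : E → ℝ} (hη : ContDiff ℝ 1 η)
    (hc : HasCompactSupport η) :
    ∑ i, stabilityForm u (projectedField u η (b i)) =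
      (Fintype.card ι - 1) * gaussEnergy (fun x => 3 / 2 * η x ^ 2 + energyDensity η x) 0 1 -
        (Fintype.card ι - 3) * gaussEnergy (fun x => η x ^ 2 * energyDensity u x) 0 1 := by
  have := hη.continuous
  have := (contDiff_energyDensity (l := 0) hdiff).continuous
  have hint₁ := integrable_sq_add_energyDensity_mul_gauss hη hc
  have hint₂ : Integrable fun x => η x ^ 2 * energyDensity u x * gauss 0 1 x :=
    integrable_of_eq_zero_off_tsupport hc (by fun_prop) fun x hx => by
      simp [image_eq_zero_of_notMem_tsupport hx]
  have hsum : ∀ x, ∑ i, (3 / 2 * ‖projectedField u η (b i) x‖ ^ 2 +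
        secondVariationDensity u (projectedField u η (b i)) x) * gauss 0 1 x =
      (Fintype.card ι - 1) * ((3 / 2 * η x ^ 2 + energyDensity η x) * gauss 0 1 x) -
        (Fintype.card ι - 3) * (η x ^ 2 * energyDensity u x * gauss 0 1 x) := by
    intro x
    rw [← Finset.sum_mul, sum_secondVariationDensity_projectedField b hu
      (hdiff.differentiable one_ne_zero _) (hη.differentiable one_ne_zero _)]
    ring
  simp only [stabilityForm, gaussEnergy, ← Finset.mul_sum]
  rw [← integral_finsetSum _ fun i _ => integrable_stabilityForm hdiff
    (contDiff_projectedField hdiff hη (b i)) (hasCompactSupport_projectedField u hc (b i)),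
    integral_congr_ae (Eventually.of_forall hsum), integral_sub (hint₁.const_mul _)
    (hint₂.const_mul _), integral_const_mul, integral_const_mul]
  ring

lemma sum_stabilityForm_projectedField_le {η : E → ℝ} (hη : ContDiff ℝ 1 η)
    (hc : HasCompactSupport η) (hle : ∀ x, |η x| ≤ 1) {δ : ℝ} (hδ : ∀ x, ‖fderiv ℝ η x‖ ≤ δ) :
    ∑ i, stabilityForm u (projectedField u η (b i)) ≤
      (Fintype.card ι - 1) * (2⁻¹ * (3 / 2 + Module.finrank ℝ E * δ ^ 2)) -
        (Fintype.card ι - 3) * gaussEnergy (fun x => η x ^ 2 * energyDensity u x) 0 1 := by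
  have hcard : (1 : ℝ) ≤ Fintype.card ι := by
    have : Nontrivial H := nontrivial_of_ne (u 0) 0 (norm_ne_zero_iff.1 (by simp [hu]))
    have := b.toBasis.index_nonempty
    exact_mod_cast Fintype.card_pos
  have hbound : ∀ x, 3 / 2 * η x ^ 2 + energyDensity η x ≤ 3 / 2 + Module.finrank ℝ E * δ ^ 2 := by
    intro x
    have hsq : η x ^ 2 ≤ 1 := (sq_le_one_iff_abs_le_one _).2 (hle x)
    have hgrad : energyDensity η x ≤ Module.finrank ℝ E * δ ^ 2 :=
      (energyDensity_le η x).trans (by gcongr; exact hδ x)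
    linarith
  have hmass : ∫ x, (3 / 2 * η x ^ 2 + energyDensity η x) * gauss 0 1 x ≤
      3 / 2 + Module.finrank ℝ E * δ ^ 2 := by
    calc ∫ x, (3 / 2 * η x ^ 2 + energyDensity η x) * gauss 0 1 x
        ≤ ∫ x : E, (3 / 2 + Module.finrank ℝ E * δ ^ 2) * gauss 0 1 x :=
          integral_mono (integrable_sq_add_energyDensity_mul_gauss hη hc)
            ((integrable_gauss 0 one_pos).const_mul _) fun x =>
              mul_le_mul_of_nonneg_right (hbound x) (gauss_pos 0 one_pos x).le
      _ = 3 / 2 + Module.finrank ℝ E * δ ^ 2 := by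
          rw [integral_const_mul, integral_gauss 0 one_pos, mul_one]
  rw [sum_stabilityForm_projectedField b hu hdiff hη hc]
  refine sub_le_sub_right (mul_le_mul_of_nonneg_left ?_ (by linarith)) _
  rw [gaussEnergy]
  linarith

lemma exists_stabilityForm_projectedField_neg
    (hint : Integrable fun x => energyDensity u x * gauss 0 1 x)
    (hbig : 3 * (Fintype.card ι - 1 : ℝ) <
      4 * (Fintype.card ι - 3) * gaussEnergy (energyDensity u) 0 1) :
    ∃ (R : ℝ) (i : ι), 0 < R ∧ stabilityForm u (projectedField u (cutoff R) (b i)) < 0 := by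
  obtain ⟨C, -, hC⟩ := exists_norm_fderiv_cutoff_le E
  have hlim : Tendsto (fun k : ℕ =>
      (Fintype.card ι - 1) * (2⁻¹ * (3 / 2 + Module.finrank ℝ E * (C / k) ^ 2)) -
        (Fintype.card ι - 3) *
          gaussEnergy (fun x => cutoff (k : ℝ) x ^ 2 * energyDensity u x) 0 1) atTop
      (𝓝 ((Fintype.card ι - 1) * (2⁻¹ * (3 / 2 + Module.finrank ℝ E * 0 ^ 2)) -
        (Fintype.card ι - 3) * gaussEnergy (energyDensity u) 0 1)) := by
    refine (((((tendsto_const_div_atTop_nhds_zero_nat C).pow 2).const_mul _).const_add _).const_mul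
      _ |>.const_mul _).sub (Tendsto.const_mul _ ?_)
    simp only [gaussEnergy, mul_assoc]
    exact (tendsto_integral_cutoff_pow_mul 2 hint).const_mul _
  obtain ⟨k, hk, hk0⟩ := ((hlim.eventually_lt_const (u := 0) (by linarith)).and
    (eventually_gt_atTop 0)).exists
  have hR : (0 : ℝ) < k := by exact_mod_cast hk0
  have hneg := (sum_stabilityForm_projectedField_le b hu hdiff (contDiff_cutoff (k := 1) (k : ℝ))
    (hasCompactSupport_cutoff hR)
    (fun x => (abs_of_nonneg (cutoff_nonneg _ _)).trans_le (cutoff_le_one _ _))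
    (hC k hR)).trans_lt hk
  obtain ⟨i, -, hi⟩ := Finset.exists_lt_of_sum_lt (g := fun _ : ι => (0 : ℝ))
    (hneg.trans_eq Finset.sum_const_zero.symm)
  exact ⟨k, i, hR, hi⟩

end Destabilizing

section SphereValued

variable {m n : ℕ} {f : Euc m → Sph n}

lemma isTangentField_projectedField (hf : IsSmooth f) {η : Euc m → ℝ} (hη : ContDiff ℝ ∞ η)
    (hc : HasCompactSupport η) (ξ : Euc (n + 1)) :
    IsTangentField f (projectedField (ambient f) η ξ) where
  smooth := contDiff_projectedField (contDiff_ambient hf) hη ξ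
  compact := hasCompactSupport_projectedField _ hc ξ
  tangent x := by
    rw [projectedField, inner_smul_right, inner_sub_right, inner_smul_right,
      real_inner_self_eq_norm_sq, norm_ambient]
    simp

lemma IsSoliton.exists_entropy_variation_lt (hn : 3 ≤ n) (hf : IsSoliton f)
    (hfin : entropy f ≠ ⊤) (hcyl : ¬ IsCylindrical f)
    (hbig : ENNReal.ofReal (3 * (n : ℝ) / (4 * ((n : ℝ) - 2))) < entropy f) :
    ∃ (W : Euc m → Euc (n + 1)) (hW : IsTangentField f W),
      ∀ᶠ s in 𝓝[≠] (0 : ℝ), entropy (variation hW s) < entropy f := by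
  have hn' : (0 : ℝ) < n - 2 := by
    have : (3 : ℝ) ≤ n := by exact_mod_cast hn
    linarith
  have hthreshold : (0 : ℝ) ≤ 3 * (n : ℝ) / (4 * ((n : ℝ) - 2)) := by positivity
  have hu := contDiff_ambient hf.1
  have hfin' := hasFiniteGaussEnergies_ambient hf.1 hfin
  rw [hf.entropy_eq hfin, ENNReal.ofReal_lt_ofReal_iff_of_nonneg hthreshold] at hbig
  have hpos := hthreshold.trans_lt hbig
  have hm : 2 ≤ m := by
    by_contra! hm
    exact hpos.not_ge (hf.satisfiesSolitonEquation.gaussEnergy_nonpos (hu.of_le ENat.LEInfty.out)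
      hfin' (by simpa using Nat.lt_succ_iff.1 hm))
  rw [div_lt_iff₀ (by positivity)] at hbig
  obtain ⟨R, i, hR, hq⟩ := exists_stabilityForm_projectedField_neg
    (EuclideanSpace.basisFun (Fin (n + 1)) ℝ) (norm_ambient f) (hu.of_le ENat.LEInfty.out)
    (hfin' 0 one_pos) (by simp; linarith)
  have hW := isTangentField_projectedField hf.1 (contDiff_cutoff R) (hasCompactSupport_cutoff hR)
    (EuclideanSpace.basisFun (Fin (n + 1)) ℝ i)
  exact ⟨_, hW, hf.eventually_entropy_variation_lt hfin hm hcyl hpos hW hq⟩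

end SphereValued

section UniformlyClose

variable {X E G : Type*} [NormedAddCommGroup X] [NormedSpace ℝ X] [NormedAddCommGroup E]
  [NormedSpace ℝ E] [NormedAddCommGroup G] [NormedSpace ℝ G] {h : X × E → G} {j : ℕ}

lemma iteratedFDeriv_slice (hh : ContDiff ℝ j h) (s : X) (x : E) :
    iteratedFDeriv ℝ j (fun y => h (s, y)) x =
      (iteratedFDeriv ℝ j h (s, x)).compContinuousLinearMap
        fun _ => ContinuousLinearMap.inr ℝ X E := by
  have hshift : ContDiff ℝ j (fun z : X × E => h (z + (s, 0))) := by fun_prop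
  have hslice : (fun z : X × E => h (z + (s, 0))) ∘ ContinuousLinearMap.inr ℝ X E =
      fun y => h (s, y) := by
    ext y; simp
  rw [← hslice, (ContinuousLinearMap.inr ℝ X E).iteratedFDeriv_comp_right hshift x le_rfl,
    iteratedFDeriv_comp_add_right]
  simp

lemma continuous_iteratedFDeriv_slice (hh : ContDiff ℝ j h) :
    Continuous fun p : X × E => iteratedFDeriv ℝ j (fun y => h (p.1, y)) p.2 := by
  simp only [iteratedFDeriv_slice hh]
  exact (ContinuousMultilinearMap.compContinuousLinearMapL (F := G) (𝕜 := ℝ)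
    (fun _ : Fin j => ContinuousLinearMap.inr ℝ X E)).continuous.comp
    (hh.continuous_iteratedFDeriv le_rfl)

lemma eventually_forall_norm_iteratedFDeriv_slice_lt (hh : ContDiff ℝ j h) {s₀ : X}
    (hzero : ∀ y, h (s₀, y) = 0) {K : Set E} (hK : IsCompact K)
    (hoff : ∀ s, ∀ y ∉ K, h (s, y) = 0) {ε : ℝ} (hε : 0 < ε) :
    ∀ᶠ s in 𝓝 s₀, ∀ x, ‖iteratedFDeriv ℝ j (fun y => h (s, y)) x‖ < ε := by
  have hon : ∀ᶠ s in 𝓝 s₀, ∀ x ∈ K, ‖iteratedFDeriv ℝ j (fun y => h (s, y)) x‖ < ε :=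
    hK.eventually_forall_of_forall_eventually fun x _ =>
      (continuous_iteratedFDeriv_slice hh).norm.continuousAt.eventually_lt continuousAt_const <| by
        simpa only [hzero, iteratedFDeriv_fun_zero, Pi.zero_apply, norm_zero] using hε
  filter_upwards [hon] with s hs x
  by_cases hx : x ∈ K
  · exact hs x hx
  · have hnear : (fun y => h (s, y)) =ᶠ[𝓝 x] fun _ => 0 := by
      filter_upwards [hK.isClosed.isOpen_compl.mem_nhds hx] with y hy using hoff s y hy
    rw [(hnear.iteratedFDeriv (𝕜 := ℝ) j).eq_of_nhds, iteratedFDeriv_fun_zero]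
    simpa using hε

lemma eventually_uniformlyClose_variation {m n : ℕ} {f : Euc m → Sph n} (hf : IsSmooth f)
    {W : Euc m → Euc (n + 1)} (hW : IsTangentField f W) (k : ℕ) {ε : ℝ} (hε : 0 < ε) :
    ∀ᶠ s in 𝓝 (0 : ℝ), UniformlyClose k ε f (variation hW s) := by
  have hsmooth : ContDiff ℝ ∞ fun p : ℝ × Euc m => ambient (variation hW p.1) p.2 - ambient f p.2 :=
    (contDiff_variation_uncurried hf hW).sub ((contDiff_ambient hf).comp contDiff_snd)
  have hclose : ∀ j ∈ Set.Iic k, ∀ᶠ s in 𝓝 (0 : ℝ), ∀ x,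
      ‖iteratedFDeriv ℝ j (fun y => ambient (variation hW s) y - ambient f y) x‖ < ε := by
    refine fun j _ => eventually_forall_norm_iteratedFDeriv_slice_lt
      (hsmooth.of_le ENat.LEInfty.out) (fun y => ?_) hW.compact (fun s y hy => ?_) hε
    · simp only [variation_zero, sub_self]
    · simp only [ambient, variation_eq_of_eq_zero hW s (image_eq_zero_of_notMem_tsupport hy),
        sub_self]
  exact (eventually_all_finite (Set.finite_Iic k)).2 hclose

end UniformlyClose

section Splitting

lemma exists_splitting {m : ℕ} (Z : Submodule ℝ (Euc m)) :
    ∃ (p q : ℕ) (e : Euc m ≃ₗᵢ[ℝ] WithLp 2 (Euc p × Euc q)), ∀ x, x ∈ Z ↔ (e x).fst = 0 := by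
  let e := Zᗮ.orthogonalDecomposition.trans
    (LinearIsometryEquiv.withLpProdCongr 2 (stdOrthonormalBasis ℝ Zᗮ).repr
      (stdOrthonormalBasis ℝ Zᗮᗮ).repr)
  refine ⟨_, _, e, fun x => ?_⟩
  have h : (e x).fst = (stdOrthonormalBasis ℝ Zᗮ).repr (Zᗮ.orthogonalProjectionOnto x) := by
    simp [e, Submodule.orthogonalDecomposition_apply]
  rw [h, LinearIsometryEquiv.map_eq_zero_iff, Submodule.orthogonalProjectionOnto_eq_zero_iff,
    Submodule.orthogonal_orthogonal]

variable {E P Q H : Type*} [NormedAddCommGroup E] [InnerProductSpace ℝ E]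
  [NormedAddCommGroup P] [InnerProductSpace ℝ P] [NormedAddCommGroup Q] [InnerProductSpace ℝ Q]
  [NormedAddCommGroup H] [InnerProductSpace ℝ H]

/-- The first component of an orthogonal splitting. -/
def splitFst (e : E ≃ₗᵢ[ℝ] WithLp 2 (P × Q)) : E →L[ℝ] P :=
  (WithLp.fstL 2 ℝ P Q).comp (e : E →L[ℝ] WithLp 2 (P × Q))

/-- The inclusion of the first factor of an orthogonal splitting. -/
def splitInl (e : E ≃ₗᵢ[ℝ] WithLp 2 (P × Q)) : P →L[ℝ] E :=
  (e.symm : WithLp 2 (P × Q) →L[ℝ] E).comp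
    (((WithLp.prodContinuousLinearEquiv 2 ℝ P Q).symm : P × Q →L[ℝ] WithLp 2 (P × Q)).comp
      (ContinuousLinearMap.inl ℝ P Q))

variable (e : E ≃ₗᵢ[ℝ] WithLp 2 (P × Q))

lemma splitFst_apply (x : E) : splitFst e x = (e x).fst := rfl

lemma splitFst_splitInl (z : P) : splitFst e (splitInl e z) = z := by
  simp [splitFst, splitInl]

lemma norm_splitFst_le : ‖splitFst e‖ ≤ 1 := by
  refine ContinuousLinearMap.opNorm_le_bound _ zero_le_one fun x => ?_
  rw [one_mul, ← e.norm_map x, splitFst_apply]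
  exact WithLp.norm_fst_le _ (e x)

lemma fderiv_comp_splitFst {u : P → H} (hu : Differentiable ℝ u) (x v : E) :
    fderiv ℝ (u ∘ splitFst e) x v = fderiv ℝ u (splitFst e x) (splitFst e v) := by
  rw [fderiv_comp x (hu _) (splitFst e).differentiableAt, ContinuousLinearMap.fderiv,
    ContinuousLinearMap.comp_apply]

variable [FiniteDimensional ℝ P] [FiniteDimensional ℝ Q]

/-- An orthonormal basis adapted to an orthogonal splitting. -/
def splitBasis : OrthonormalBasis (Fin (Module.finrank ℝ P) ⊕ Fin (Module.finrank ℝ Q)) ℝ E :=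
  ((stdOrthonormalBasis ℝ P).prod (stdOrthonormalBasis ℝ Q)).map e.symm

lemma splitFst_splitBasis_inl (i : Fin (Module.finrank ℝ P)) :
    splitFst e (splitBasis e (Sum.inl i)) = stdOrthonormalBasis ℝ P i := by
  simp [splitFst_apply, splitBasis]

lemma splitFst_splitBasis_inr (i : Fin (Module.finrank ℝ Q)) :
    splitFst e (splitBasis e (Sum.inr i)) = 0 := by
  simp [splitFst_apply, splitBasis]

lemma gauss_splitting (x₀ x : E) {t : ℝ} (ht : 0 < t) :
    gauss x₀ t x = gauss (e x₀).fst t (e x).fst * gauss (e x₀).snd t (e x).snd := by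
  have hdim : (Module.finrank ℝ E : ℝ) = Module.finrank ℝ P + Module.finrank ℝ Q := by
    rw [e.toLinearEquiv.finrank_eq, (WithLp.linearEquiv 2 ℝ (P × Q)).finrank_eq,
      Module.finrank_prod, Nat.cast_add]
  have hnorm : ‖x - x₀‖ ^ 2 = ‖(e x).fst - (e x₀).fst‖ ^ 2 + ‖(e x).snd - (e x₀).snd‖ ^ 2 := by
    rw [← e.norm_map (x - x₀), WithLp.prod_norm_sq_eq_of_L2, map_sub, WithLp.sub_fst,
      WithLp.sub_snd]
  unfold gauss
  rw [hnorm, hdim, add_div, Real.rpow_add (by positivity), div_mul_div_comm, ← Real.exp_add]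
  congr 2
  ring

variable [FiniteDimensional ℝ E]

lemma energyDensity_comp_splitFst {u : P → H} (hu : Differentiable ℝ u) (x : E) :
    energyDensity (u ∘ splitFst e) x = energyDensity u (splitFst e x) := by
  rw [energyDensity_eq_sum_norm_sq (splitBasis e),
    energyDensity_eq_sum_norm_sq (stdOrthonormalBasis ℝ P), Fintype.sum_sum_type]
  simp [fderiv_comp_splitFst e hu, splitFst_splitBasis_inl, splitFst_splitBasis_inr]

lemma laplacian_comp_splitFst {u : P → H} (hu : ContDiff ℝ 2 u) (x : E) :
    Laplacian.laplacian (u ∘ splitFst e) x = Laplacian.laplacian u (splitFst e x) := by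
  rw [InnerProductSpace.laplacian_eq_iteratedFDeriv_orthonormalBasis _ (splitBasis e),
    InnerProductSpace.laplacian_eq_iteratedFDeriv_stdOrthonormalBasis]
  simp [(splitFst e).iteratedFDeriv_comp_right hu x le_rfl, iteratedFDeriv_two_apply,
    splitFst_splitBasis_inl, splitFst_splitBasis_inr]

variable [MeasurableSpace E] [BorelSpace E] [MeasurableSpace P] [BorelSpace P]
  [MeasurableSpace Q] [BorelSpace Q]

lemma lintegral_mul_gauss_comp_splitFst {h : P → ℝ} (hh : Continuous h) (hnonneg : 0 ≤ h) (x₀ : E)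
    {t : ℝ} (ht : 0 < t) :
    ∫⁻ x, ENNReal.ofReal (h (splitFst e x) * gauss x₀ t x) =
      ∫⁻ z, ENNReal.ofReal (h z * gauss (splitFst e x₀) t z) := by
  have hmass : ∫⁻ w, ENNReal.ofReal (gauss (e x₀).snd t w) = 1 := by
    rw [← ofReal_integral_eq_lintegral_ofReal (integrable_gauss _ ht)
      (Eventually.of_forall fun w => (gauss_pos _ ht w).le), integral_gauss _ ht,
      ENNReal.ofReal_one]
  have hmP : Measurable fun z => ENNReal.ofReal (h z * gauss (splitFst e x₀) t z) :=
    (hh.mul (continuous_gauss _ t)).measurable.ennreal_ofReal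
  have hmQ : Measurable fun w => ENNReal.ofReal (gauss (e x₀).snd t w) :=
    (continuous_gauss _ t).measurable.ennreal_ofReal
  have hpreserving : MeasurePreserving fun x => (WithLp.ofLp (e x) : P × Q) :=
    (WithLp.volume_preserving_ofLp P Q).comp e.measurePreserving
  calc ∫⁻ x, ENNReal.ofReal (h (splitFst e x) * gauss x₀ t x)
      = ∫⁻ x, ENNReal.ofReal (h (e x).fst * gauss (splitFst e x₀) t (e x).fst) *
          ENNReal.ofReal (gauss (e x₀).snd t (e x).snd) := by
        refine lintegral_congr fun x => ?_
        rw [gauss_splitting e x₀ x ht, ← mul_assoc, ENNReal.ofReal_mul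
          (mul_nonneg (hnonneg _) (gauss_pos _ ht _).le)]
        rfl
    _ = ∫⁻ y : P × Q, ENNReal.ofReal (h y.1 * gauss (splitFst e x₀) t y.1) *
          ENNReal.ofReal (gauss (e x₀).snd t y.2) :=
        hpreserving.lintegral_comp ((hmP.comp measurable_fst).mul (hmQ.comp measurable_snd))
    _ = ∫⁻ z, ENNReal.ofReal (h z * gauss (splitFst e x₀) t z) := by
        rw [Measure.volume_eq_prod, lintegral_prod_mul hmP.aemeasurable hmQ.aemeasurable, hmass,
          mul_one]

end Splitting

section PullBack

variable {m n p q : ℕ} (e : Euc m ≃ₗᵢ[ℝ] WithLp 2 (Euc p × Euc q)) {g : Euc p → Sph n}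
  (hg : IsSmooth g)
include hg

lemma IsSmooth.comp_splitFst : IsSmooth (g ∘ splitFst e) :=
  ContMDiff.comp hg (splitFst e).contDiff.contMDiff

lemma functionalF_comp_splitFst (x₀ : Euc m) {t : ℝ} (ht : 0 < t) :
    functionalF x₀ t (g ∘ splitFst e) = functionalF (splitFst e x₀) t g := by
  have hdensity : energyDensity (ambient (g ∘ splitFst e)) =
      energyDensity (ambient g) ∘ splitFst e :=
    funext (energyDensity_comp_splitFst e ((contDiff_ambient hg).differentiable (by simp)))
  rw [functionalF_eq_lintegral, functionalF_eq_lintegral, hdensity]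
  exact congrArg _ (lintegral_mul_gauss_comp_splitFst e (continuous_energyDensity_ambient hg)
    (energyDensity_nonneg _) x₀ ht)

lemma entropy_comp_splitFst : entropy (g ∘ splitFst e) = entropy g := by
  refine le_antisymm (iSup₂_le fun x₀ t => iSup_le fun ht => ?_)
    (iSup₂_le fun z t => iSup_le fun ht => ?_)
  · rw [functionalF_comp_splitFst e hg x₀ ht]
    exact functionalF_le_entropy g _ ht
  · rw [← splitFst_splitInl e z, ← functionalF_comp_splitFst e hg _ ht]
    exact functionalF_le_entropy _ _ ht

lemma tension_comp_splitFst (x : Euc m) :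
    tension (g ∘ splitFst e) x = tension g (splitFst e x) :=
  congrArg (ℝ ∙ ambient g (splitFst e x))ᗮ.starProjection
    (laplacian_comp_splitFst e ((contDiff_ambient hg).of_le ENat.LEInfty.out) x)

lemma fderiv_ambient_comp_splitFst (x v : Euc m) :
    fderiv ℝ (ambient (g ∘ splitFst e)) x v =
      fderiv ℝ (ambient g) (splitFst e x) (splitFst e v) :=
  fderiv_comp_splitFst e ((contDiff_ambient hg).differentiable (by simp)) x v

lemma isSoliton_of_comp_splitFst (h : IsSoliton (g ∘ splitFst e)) : IsSoliton g := by
  refine ⟨hg, fun z => ?_⟩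
  have hz := h.2 (splitInl e z)
  rwa [tension_comp_splitFst e hg, fderiv_ambient_comp_splitFst e hg, map_smul,
    splitFst_splitInl] at hz

lemma UniformlyClose.comp_splitFst {k : ℕ} {ε : ℝ} {g' : Euc p → Sph n} (hg' : IsSmooth g')
    (h : UniformlyClose k ε g g') : UniformlyClose k ε (g ∘ splitFst e) (g' ∘ splitFst e) := by
  intro j hj x
  have hsmooth : ContDiff ℝ ∞ fun y => ambient g' y - ambient g y :=
    (contDiff_ambient hg').sub (contDiff_ambient hg)
  calc ‖iteratedFDeriv ℝ j ((fun y => ambient g' y - ambient g y) ∘ splitFst e) x‖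
      ≤ ‖iteratedFDeriv ℝ j (fun y => ambient g' y - ambient g y) (splitFst e x)‖ *
          ∏ _ : Fin j, ‖splitFst e‖ := by
        rw [(splitFst e).iteratedFDeriv_comp_right hsmooth x ENat.LEInfty.out]
        exact ContinuousMultilinearMap.norm_compContinuousLinearMap_le _ _
    _ ≤ ‖iteratedFDeriv ℝ j (fun y => ambient g' y - ambient g y) (splitFst e x)‖ :=
        mul_le_of_le_one_right (norm_nonneg _)
          (Finset.prod_le_one (fun _ _ => norm_nonneg _) fun _ _ => norm_splitFst_le e)
    _ < ε := h j hj (splitFst e x)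

end PullBack

section Reduction

variable {E H : Type*} [NormedAddCommGroup E] [NormedSpace ℝ E] [NormedAddCommGroup H]
  [NormedSpace ℝ H]

/-- The constant directions along which `u` is invariant. -/
def invariantDirections (u : E → H) : Submodule ℝ E :=
  ⨅ x, (fderiv ℝ u x).ker

lemma mem_invariantDirections {u : E → H} {ζ : E} :
    ζ ∈ invariantDirections u ↔ ∀ x, fderiv ℝ u x ζ = 0 := by
  simp [invariantDirections]

lemma apply_add_of_mem_invariantDirections {u : E → H} (hu : Differentiable ℝ u) {ζ : E}
    (hζ : ζ ∈ invariantDirections u) (x : E) : u (x + ζ) = u x := by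
  have hderiv : ∀ t : ℝ, HasDerivAt (fun t : ℝ => u (x + t • ζ)) 0 t := by
    intro t
    have hline : HasDerivAt (fun t : ℝ => x + t • ζ) ((1 : ℝ) • ζ) t :=
      ((hasDerivAt_id t).smul_const ζ).const_add x
    have hcomp := (hu (x + t • ζ)).hasFDerivAt.comp_hasDerivAt t hline
    rwa [one_smul, mem_invariantDirections.1 hζ] at hcomp
  simpa using
    is_const_of_deriv_eq_zero (fun t => (hderiv t).differentiableAt) (fun t => (hderiv t).deriv) 1 0

lemma IsSoliton.exists_eq_comp_splitFst {m n : ℕ} {f : Euc m → Sph n} (hf : IsSoliton f) :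
    ∃ (p q : ℕ) (e : Euc m ≃ₗᵢ[ℝ] WithLp 2 (Euc p × Euc q)) (g : Euc p → Sph n),
      f = g ∘ splitFst e ∧ IsSoliton g ∧ ¬ IsCylindrical g := by
  obtain ⟨p, q, e, he⟩ := exists_splitting (invariantDirections (ambient f))
  have hg : IsSmooth (f ∘ splitInl e) := ContMDiff.comp hf.1 (splitInl e).contDiff.contMDiff
  have hfg : f = (f ∘ splitInl e) ∘ splitFst e := by
    funext x
    have hζ : x - splitInl e (splitFst e x) ∈ invariantDirections (ambient f) := by
      rw [he, ← splitFst_apply, map_sub, splitFst_splitInl, sub_self]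
    have hinvariant := apply_add_of_mem_invariantDirections
      ((contDiff_ambient hf.1).differentiable (by simp)) hζ (splitInl e (splitFst e x))
    rw [add_sub_cancel] at hinvariant
    exact Subtype.ext hinvariant
  refine ⟨p, q, e, f ∘ splitInl e, hfg, isSoliton_of_comp_splitFst e hg (hfg ▸ hf), ?_⟩
  rintro ⟨ζ, hζ, hζ0⟩
  have hmem : splitInl e ζ ∈ invariantDirections (ambient f) := by
    rw [mem_invariantDirections, hfg]
    intro x
    rw [fderiv_ambient_comp_splitFst e hg, splitFst_splitInl, hζ0]
  rw [he, ← splitFst_apply, splitFst_splitInl] at hmem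
  exact hζ hmem

end Reduction

end HarmonicSoliton

end

theorem theorem1p3 (m n : ℕ) (hn : 3 ≤ n)
    (f : HarmonicSoliton.Euc m → HarmonicSoliton.Sph n)
    (hf : HarmonicSoliton.IsSoliton f)
    (hfin : HarmonicSoliton.entropy f ≠ ⊤) :
    (HarmonicSoliton.IsEntropyStable f →
      HarmonicSoliton.entropy f ≤ ENNReal.ofReal (3 * (n : ℝ) / (4 * ((n : ℝ) - 2)))) ∧
    (¬ HarmonicSoliton.IsCylindrical f → HarmonicSoliton.IsCompactlyEntropyStable f →
      HarmonicSoliton.entropy f ≤ ENNReal.ofReal (3 * (n : ℝ) / (4 * ((n : ℝ) - 2)))) := by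
  constructor
  · rintro ⟨k, ε, hε, hmin⟩
    by_contra! hbig
    obtain ⟨p, q, e, g, rfl, hg, hcyl⟩ := hf.exists_eq_comp_splitFst
    rw [HarmonicSoliton.entropy_comp_splitFst e hg.1] at hfin hbig hmin
    obtain ⟨W, hW, hlt⟩ := hg.exists_entropy_variation_lt hn hfin hcyl hbig
    have hclose := (HarmonicSoliton.eventually_uniformlyClose_variation hg.1 hW k hε).filter_mono
      (nhdsWithin_le_nhds (s := {0}ᶜ))
    obtain ⟨s, hlt_s, hclose_s⟩ := (hlt.and hclose).exists
    have hsmooth := HarmonicSoliton.isSmooth_variation hg.1 hW s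
    have hle := hmin _ (hsmooth.comp_splitFst e) (hclose_s.comp_splitFst e hg.1 hsmooth)
    rw [HarmonicSoliton.entropy_comp_splitFst e hsmooth] at hle
    exact absurd hlt_s hle.not_gt
  · intro hcyl hmin
    by_contra! hbig
    obtain ⟨W, hW, hlt⟩ := hf.exists_entropy_variation_lt hn hfin hcyl hbig
    have hle := (hmin _ (HarmonicSoliton.isCompactVariation_variation hf.1 hW)).filter_mono
      (nhdsWithin_le_nhds (s := {0}ᶜ))
    obtain ⟨s, hlt_s, hle_s⟩ := (hlt.and hle).exists
    simp only [HarmonicSoliton.variation_zero hW] at hle_s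
    exact absurd hlt_s hle_s.not_gt
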